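/- Let $q \ge 2$ be a fixed integer. All graphs are finite and simple. Let $\mathcal F$ be one of the following four graph classes: the graphs without edges (\textsc{Independent}); the disjoint unions of split graphs (a graph is split if its vertex set can be partitioned into a clique and an independent set); the disjoint unions of cochordal graphs (a graph is cochordal if its edge complement has no induced cycle of length at least $4$); the cographs (graphs without an induced path on four vertices). An instance of \textsc{$q$-Coloring} on $\mathcal F + kv$ graphs consists of a graph $G$ and a set $X \subseteq V(G)$ (a modulator) with $|X| = k$ such that $G - X \in \mathcal F$; the question is whether $G$ has a proper coloring with colors $\{1,\dots,q\}$. An instance of \textsc{$q$-List-Coloring} on $\mathcal F + kv$ graphs has in addition a list $\Lambda(v) \subseteq \{1,\dots,q\}$ for every vertex $v$; the question is whether $G$ has a proper coloring that gives every vertex $v$ a color from $\Lambda(v)$. Then there is an $\varepsilon$ with $0 < \varepsilon < q$ (depending only on $q$) such that, for each of the four classes $\mathcal F$, both problems can be solved in time $\mathcal O^*((q-\varepsilon)^k)$. That is, for each of the four classes and each of the two problems there are a (deterministic, multitape) Turing machine and a polynomial $p$ such that on every instance, given by $G$, $X$ (and $\Lambda$) in a standard binary encoding of length $L$, the machine halts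 with the correct answer after at most $p(L)\cdot (q-\varepsilon)^k$ steps, where $k = |X|$. -/

import Mathlib

/-- A class of graphs, given as a predicate on graphs. -/
abbrev GraphClass : Type 1 := ∀ V : Type, SimpleGraph V → Prop

namespace GraphClass

/-- Graphs without edges. -/
def independent : GraphClass := fun _ G => ∀ u v, ¬ G.Adj u v

/-- Split graphs: the vertex set is partitioned into a clique `W` and an independent set `Wᶜ`. -/
def split : GraphClass := fun V G => ∃ W : Set V, G.IsClique W ∧ G.IsIndepSet Wᶜ

/-- Chordal graphs: no induced cycle on `m ≥ 4` vertices. -/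
def chordal : GraphClass := fun _ G =>
  ∀ m : ℕ, 4 ≤ m → ¬ (SimpleGraph.cycleGraph m).IsIndContained G

/-- Cochordal graphs: edge complements of chordal graphs. -/
def cochordal : GraphClass := fun V G => chordal V Gᶜ

/-- Cographs: no induced path on four vertices. -/
def cograph : GraphClass := fun _ G => ¬ (SimpleGraph.pathGraph 4).IsIndContained G

/-- Disjoint unions of graphs from `C`: the vertex set is partitioned into the classes of an
equivalence relation `s`, no edge joins two different classes, and every class induces a
graph of `C`. -/
def disjointUnions (C : GraphClass) : GraphClass := fun V G =>
  ∃ s : Setoid V, (∀ u v, G.Adj u v → s u v) ∧ ∀ v, C {u | s u v} (G.induce {u | s u v})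

end GraphClass

/-- A parameterized (promise) decision problem: instances, their encoding as binary words, their
parameter, and which of them are yes-instances. -/
structure ParamProblem where
  /-- the admissible instances -/
  Inst : Type
  /-- the word that an algorithm reads -/
  encode : Inst → List Bool
  /-- the parameter `k` -/
  param : Inst → ℕ
  /-- the yes-instances -/
  IsYes : Inst → Prop

open Classical in
/-- `P` can be solved in time `O*(b ^ k)`: there are one Turing machine (with finitely many
stacks, that is, a multitape machine) and one polynomial `p` such that on every instance of size
`L` and with parameter `k` the machine halts with the right answer after at most
`p(L) * b ^ k` steps. -/
def ParamProblem.SolvableInOStar (P : ParamProblem) (b : ℝ) : Prop :=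
  ∃ (M : Turing.TM2ComputableAux Bool Bool) (p : Polynomial ℕ), ∀ x : P.Inst, ∃ t : ℕ,
    (t : ℝ) ≤ (p.eval (P.encode x).length : ℕ) * b ^ P.param x ∧
    Nonempty (Turing.TM2OutputsInTime M.tm
      ((P.encode x).map M.inputAlphabet.symm)
      (some ((Computability.encodeBool (decide (P.IsYes x))).map M.outputAlphabet.symm))
      t)

/-- A graph (with vertices `0, …, n - 1`) given together with a modulator to `F`, that is, a set
`modulator` of vertices whose removal leaves a graph in `F`. -/
structure ModulatorGraph (F : GraphClass) where
  /-- the number of vertices -/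
  n : ℕ
  /-- the graph -/
  graph : SimpleGraph (Fin n)
  /-- the given modulator `X` -/
  modulator : Finset (Fin n)
  /-- `G - X` belongs to `F` -/
  rest_mem : F {v | v ∉ modulator} (graph.induce {v | v ∉ modulator})

open Classical in
/-- The binary encoding of a graph with a modulator: `n` in unary, the adjacency matrix row by
row, and the characteristic vector of the modulator. -/
noncomputable def ModulatorGraph.encode {F : GraphClass} (I : ModulatorGraph F) : List Bool :=
  List.replicate I.n true ++ [false]
    ++ (List.finRange I.n).flatMap (fun u => (List.finRange I.n).map fun v => decide (I.graph.Adj u v))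
    ++ (List.finRange I.n).map (fun v => decide (v ∈ I.modulator))

/-- `q`-Coloring on `F + kv` graphs, parameterized by the size of the given modulator. -/
noncomputable def qColoring (q : ℕ) (F : GraphClass) : ParamProblem where
  Inst := ModulatorGraph F
  encode I := I.encode
  param I := I.modulator.card
  IsYes I := I.graph.Colorable q

/-- `q`-List-Coloring on `F + kv` graphs, parameterized by the size of the given modulator. An
instance has in addition a list `Λ v` of allowed colors for every vertex `v`; the lists are
encoded, after the graph and the modulator, by their characteristic vectors. -/
noncomputable def qListColoring (q : ℕ) (F : GraphClass) : ParamProblem where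
  Inst := (I : ModulatorGraph F) × (Fin I.n → Finset (Fin q))
  encode := fun ⟨I, Λ⟩ => I.encode
    ++ (List.finRange I.n).flatMap (fun v => (List.finRange q).map fun c => decide (c ∈ Λ v))
  param := fun ⟨I, _⟩ => I.modulator.card
  IsYes := fun ⟨I, Λ⟩ => ∃ γ : I.graph.Coloring (Fin q), ∀ v, γ v ∈ Λ v

/-! The four classes share one property: with lists from `q` colors, every uncolorable instance on a
graph of the class contains an uncolorable one on at most `c` vertices, where `c` depends only on
`q` (`ListColoring.exists_bounded`). Put `m = 2 + c * (1 + q)`. If a coloring of the modulator `X`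
does not extend to all of `G`, then it already fails to extend to some set of at most `m` vertices:
either an edge or a list inside `X` is violated, or there is a certificate of at most `c` vertices
outside `X`, together with one modulator neighbor for each of its vertices and each color that is
forbidden there (`Branching.listCol_of_local`).

This gives a branching algorithm. It keeps a list of partial assignments of `X` and runs once
through all `m`-tuples of vertices. For a tuple and an assignment `a`, let `s` be the number of
unassigned modulator vertices in the tuple. At most `q ^ s` colorings of the modulator part of the
tuple are compatible with `a`. If all of them extend to the tuple, `a` is kept. Otherwise `a` is
replaced by its refinements along those that do extend, and there are at most `q ^ s - 1` of these.
Choose `1 ≤ β < q` with `q ^ s - 1 ≤ β ^ s` for all `s ≤ m` (`Branching.exists_base`). Then the sum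
of `β ^ (number of free modulator vertices)` over the list never grows
(`Branching.potential_step_le`), so the list never has more than `β ^ k` members. No solution is
lost, and at the end every completion of a surviving assignment extends to every tuple, hence to `G`
(`Branching.processTuples_ne_nil_iff`).

The certificates come from induction on the number of colors. A cograph with at least two vertices
is a disjoint union or a join. In a join the two sides use disjoint color sets, so it suffices to
refute every splitting of the colors (`ListColoring.hasCert_of_join`). A cochordal graph has a
vertex `v` whose non-neighbors are independent. Once `v` has color `c`, all non-neighbors that allow
`c` may receive it too, and one color fewer remains (`ListColoring.bounded_of_cochordal`). Split
graphs are cochordal, edgeless graphs are cographs, and disjoint unions preserve the bound.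

The machine is written in a small structured language that compiles to `TM2` with exact step counts
(`StackProg.Run.steps`). Since `q` and `m` are constants, everything that the branching rule needs
to know about a tuple fits into the finite control. -/

open Turing

/-! ### Structured stack programs and their compilation to Turing machines. -/

/-- Structured programs over a family of stacks with alphabets `Γ k` and a control register of
type `σ`. The conditions of `ite` and `while` may inspect the top of one stack. -/
inductive StackProg {K : Type} (Γ : K → Type) (σ : Type) : Type
  | push (k : K) (f : σ → Γ k)
  | pop (k : K) (f : σ → Option (Γ k) → σ)
  | load (f : σ → σ)
  | seq (p q : StackProg Γ σ)
  | ite (k : K) (c : σ → Option (Γ k) → Bool) (p q : StackProg Γ σ)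
  | while (k : K) (c : σ → Option (Γ k) → Bool) (p : StackProg Γ σ)

namespace StackProg

variable {K : Type} {Γ : K → Type} {σ : Type}

/-- `Run p v S v' S' t`: started with register `v` and stacks `S`, the program `p` ends with
register `v'` and stacks `S'` after exactly `t` machine steps. -/
inductive Run [DecidableEq K] : StackProg Γ σ → σ → (∀ k, List (Γ k)) → σ → (∀ k, List (Γ k)) → ℕ → Prop
  | push (k f v S) : Run (.push k f) v S v (Function.update S k (f v :: S k)) 1
  | pop (k f v S) : Run (.pop k f) v S (f v (S k).head?) (Function.update S k (S k).tail) 1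
  | load (f v S) : Run (.load f) v S (f v) S 1
  | seq {p q v S v₁ S₁ v₂ S₂ t₁ t₂} : Run p v S v₁ S₁ t₁ → Run q v₁ S₁ v₂ S₂ t₂ →
      Run (.seq p q) v S v₂ S₂ (t₁ + t₂)
  | ite_true {k c p q v S v' S' t} : c v (S k).head? = true → Run p v S v' S' t →
      Run (.ite k c p q) v S v' S' (1 + t)
  | ite_false {k c p q v S v' S' t} : c v (S k).head? = false → Run q v S v' S' t →
      Run (.ite k c p q) v S v' S' (1 + t)
  | while_false {k c p v S} : c v (S k).head? = false → Run (.while k c p) v S v S 1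
  | while_true {k c p v S v₁ S₁ v₂ S₂ t₁ t₂} : c v (S k).head? = true → Run p v S v₁ S₁ t₁ →
      Run (.while k c p) v₁ S₁ v₂ S₂ t₂ → Run (.while k c p) v S v₂ S₂ (1 + t₁ + t₂)

/-- The labels of the machine that executes a program. -/
def Lab : StackProg Γ σ → Type
  | push _ _ => Unit
  | pop _ _ => Unit
  | load _ => Unit
  | seq p q => Lab p ⊕ Lab q
  | ite _ _ p q => Option (Lab p ⊕ Lab q)
  | .while _ _ p => Option (Lab p)

instance Lab.finite : (p : StackProg Γ σ) → Finite (Lab p)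
  | push _ _ => inferInstanceAs (Finite Unit)
  | pop _ _ => inferInstanceAs (Finite Unit)
  | load _ => inferInstanceAs (Finite Unit)
  | seq p q => have := Lab.finite p; have := Lab.finite q; inferInstanceAs (Finite (Lab p ⊕ Lab q))
  | ite _ _ p q =>
    have := Lab.finite p; have := Lab.finite q; inferInstanceAs (Finite (Option (Lab p ⊕ Lab q)))
  | .while _ _ p => have := Lab.finite p; inferInstanceAs (Finite (Option (Lab p)))

/-- The label at which the execution of a program starts. -/
def entry : (p : StackProg Γ σ) → Lab p
  | push _ _ => ()
  | pop _ _ => ()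
  | load _ => ()
  | seq p _ => Sum.inl (entry p)
  | ite _ _ _ _ => (none : Option _)
  | .while _ _ _ => (none : Option _)

/-- The machine statement at each label of a program that is embedded by `emb` into the labels of a
machine and that continues at the label `ex`. The second component of the machine register holds
the value of the last condition. -/
def code {Λ : Type} : (p : StackProg Γ σ) → (Lab p → Λ) → Λ → Lab p → TM2.Stmt Γ Λ (σ × Bool)
  | push k f, _, ex, _ => .push k (fun v => f v.1) (.goto fun _ => ex)
  | pop k f, _, ex, _ => .pop k (fun v o => (f v.1 o, v.2)) (.goto fun _ => ex)
  | load f, _, ex, _ => .load (fun v => (f v.1, v.2)) (.goto fun _ => ex)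
  | seq p q, emb, ex, l => Sum.elim
      (fun l => code p (fun l => emb (.inl l)) (emb (.inr (entry q))) l)
      (fun l => code q (fun l => emb (.inr l)) ex l) l
  | ite k c p q, emb, ex, l => Option.elim l
      -- Peek, branch and jump form one statement and thus cost a single step, as `Run` charges for
      -- a test.
      (.peek k (fun v o => (v.1, c v.1 o)) (.branch (fun v => v.2)
        (.goto fun _ => emb (some (.inl (entry p)))) (.goto fun _ => emb (some (.inr (entry q))))))
      (Sum.elim
        (fun l => code p (fun l => emb (some (.inl l))) ex l)
        (fun l => code q (fun l => emb (some (.inr l))) ex l))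
  | .while k c p, emb, ex, l => Option.elim l
      (.peek k (fun v o => (v.1, c v.1 o)) (.branch (fun v => v.2)
        (.goto fun _ => emb (some (entry p))) (.goto fun _ => ex)))
      (fun l => code p (fun l => emb (some l)) (emb none) l)

/-- `Steps M a b t`: the machine `M` goes from `a` to `b` in exactly `t` steps. -/
def Steps [DecidableEq K] {Λ τ : Type} (M : Λ → TM2.Stmt Γ Λ τ) (a b : TM2.Cfg Γ Λ τ) (t : ℕ) : Prop :=
  (flip bind (TM2.step M))^[t] (some a) = some b

theorem Steps.trans [DecidableEq K] {Λ τ : Type} {M : Λ → TM2.Stmt Γ Λ τ} {a b c : TM2.Cfg Γ Λ τ} {s t : ℕ}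
    (h : Steps M a b s) (h' : Steps M b c t) : Steps M a c (s + t) := by
  unfold Steps at *
  rw [Nat.add_comm, Function.iterate_add_apply, h, h']

theorem Steps.single [DecidableEq K] {Λ τ : Type} {M : Λ → TM2.Stmt Γ Λ τ} {a b : TM2.Cfg Γ Λ τ}
    (h : TM2.step M a = some b) : Steps M a b 1 := h

/-- Compiler correctness, by induction on the run. The embedding of labels and the exit label vary,
so that the hypothesis applies to subprograms. The final condition bit is left existential because
every test overwrites it before using it. -/
theorem Run.steps [DecidableEq K] {p : StackProg Γ σ} {v S v' S' t} (h : Run p v S v' S' t) :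
    ∀ {Λ : Type} (M : Λ → TM2.Stmt Γ Λ (σ × Bool)) (emb : Lab p → Λ) (ex : Λ),
      (∀ l, M (emb l) = code p emb ex l) → ∀ b, ∃ b',
        Steps M ⟨some (emb (entry p)), (v, b), S⟩ ⟨some ex, (v', b'), S'⟩ t := by
  induction h with
  | push k f v S =>
    intro Λ M emb ex hM b
    exact ⟨b, .single (by simp [TM2.step, hM, code])⟩
  | pop k f v S =>
    intro Λ M emb ex hM b
    exact ⟨b, .single (by simp [TM2.step, hM, code])⟩
  | load f v S =>
    intro Λ M emb ex hM b
    exact ⟨b, .single (by simp [TM2.step, hM, code])⟩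
  | @seq p q v S v₁ S₁ v₂ S₂ t₁ t₂ _ _ ih₁ ih₂ =>
    intro Λ M emb ex hM b
    obtain ⟨b₁, h₁⟩ := ih₁ M (fun l => emb (.inl l)) (emb (.inr (entry q)))
      (fun l => hM (.inl l)) b
    obtain ⟨b₂, h₂⟩ := ih₂ M (fun l => emb (.inr l)) ex (fun l => hM (.inr l)) b₁
    exact ⟨b₂, h₁.trans h₂⟩
  | @ite_true k c p q v S v' S' t hc _ ih =>
    intro Λ M emb ex hM b
    obtain ⟨b₁, h₁⟩ := ih M (fun l => emb (some (.inl l))) ex (fun l => hM (some (.inl l))) true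
    refine ⟨b₁, .trans (.single ?_) h₁⟩
    have := hM none
    simp only [code, Option.elim] at this
    simp [TM2.step, entry, this, hc]
  | @ite_false k c p q v S v' S' t hc _ ih =>
    intro Λ M emb ex hM b
    obtain ⟨b₁, h₁⟩ := ih M (fun l => emb (some (.inr l))) ex (fun l => hM (some (.inr l))) false
    refine ⟨b₁, .trans (.single ?_) h₁⟩
    have := hM none
    simp only [code, Option.elim] at this
    simp [TM2.step, entry, this, hc]
  | @while_false k c p v S hc =>
    intro Λ M emb ex hM b
    refine ⟨false, .single ?_⟩
    have := hM none
    simp only [code, Option.elim] at this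
    simp [TM2.step, entry, this, hc]
  | @while_true k c p v S v₁ S₁ v₂ S₂ t₁ t₂ hc _ _ ih₁ ih₂ =>
    intro Λ M emb ex hM b
    obtain ⟨b₁, h₁⟩ := ih₁ M (fun l => emb (some l)) (emb none) (fun l => hM (some l)) true
    obtain ⟨b₂, h₂⟩ := ih₂ M emb ex hM b₁
    refine ⟨b₂, .trans (.trans (.single ?_) h₁) h₂⟩
    have := hM none
    simp only [code, Option.elim] at this
    simp [TM2.step, entry, this, hc]

theorem sum_length_update [DecidableEq K] [Fintype K] (S : ∀ k, List (Γ k)) (k : K) (l : List (Γ k)) :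
    ∑ i, (Function.update S k l i).length + (S k).length = ∑ i, (S i).length + l.length := by
  rw [← Finset.add_sum_erase _ _ (Finset.mem_univ k),
    ← Finset.add_sum_erase (a := k) _ (fun k => (S k).length) (Finset.mem_univ k),
    Finset.sum_congr rfl (g := fun k => (S k).length)
      (fun x hx => by rw [Function.update_of_ne (Finset.ne_of_mem_erase hx)])]
  simp only [Function.update_self]
  omega

/-- One step adds at most one symbol. This bounds the cost of emptying the stacks before the output
by the running time. -/
theorem Run.size_le [DecidableEq K] [Fintype K] {p : StackProg Γ σ} {v S v' S' t}
    (h : Run p v S v' S' t) : ∑ k, (S' k).length ≤ ∑ k, (S k).length + t := by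
  induction h with
  | push k f v S =>
    have := sum_length_update S k (f v :: S k)
    simp only [List.length_cons] at this
    omega
  | pop k f v S =>
    have := sum_length_update S k (S k).tail
    simp only [List.length_tail] at this
    omega
  | load => omega
  | seq => omega
  | ite_true => omega
  | ite_false => omega
  | while_false => omega
  | while_true => omega

/-- The sequential composition of a list of programs. -/
def seqList : List (StackProg Γ σ) → StackProg Γ σ
  | [] => load id
  | p :: l => seq p (seqList l)

/-- Empty the stack `k`. -/
def clear (k : K) : StackProg Γ σ := .while k (fun _ o => o.isSome) (.pop k fun v _ => v)

theorem run_clear [DecidableEq K] (k : K) (v : σ) (S : ∀ k, List (Γ k)) :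
    Run (clear k) v S v (Function.update S k []) (2 * (S k).length + 1) := by
  induction h : S k generalizing S with
  | nil =>
    rw [Function.update_eq_self_iff.2 h.symm]
    exact .while_false (by simp [h])
  | cons a l ih =>
    have := ih (Function.update S k l) (by simp)
    rw [Function.update_idem] at this
    have h2 := Run.pop k (fun (v : σ) _ => v) v S
    rw [h] at h2
    have := Run.while_true (c := fun _ o => o.isSome) (by simp [h]) h2 this
    rwa [show 1 + 1 + (2 * l.length + 1) = 2 * (a :: l).length + 1 by simp; omega] at this

theorem run_clear_list [DecidableEq K] [Fintype K] (l : List K) (v : σ) (S : ∀ k, List (Γ k)) :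
    ∃ t ≤ l.length * (2 * ∑ k, (S k).length + 1) + 1,
      Run (seqList (l.map clear)) v S v (fun k => if k ∈ l then [] else S k) t := by
  induction l generalizing S with
  | nil => exact ⟨1, by simp, by simpa [seqList] using Run.load id v S⟩
  | cons k l ih =>
    obtain ⟨t, ht, h⟩ := ih (Function.update S k [])
    have h0 : ∑ i, (Function.update S k [] i).length ≤ ∑ i, (S i).length := by
      have := sum_length_update S k []
      simp only [List.length_nil] at this
      omega
    have h1 : (S k).length ≤ ∑ i, (S i).length :=
      Finset.single_le_sum (f := fun i => (S i).length) (fun _ _ => Nat.zero_le _) (Finset.mem_univ k)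
    refine ⟨2 * (S k).length + 1 + t, ?_, ?_⟩
    rotate_left
    · have := (run_clear k v S).seq h
      refine Eq.mp (congrArg (fun S' => Run _ v S v S' _) ?_) this
      funext i
      by_cases hi : i ∈ l
      · simp [hi]
      · rcases eq_or_ne i k with rfl | h'
        · simp [hi]
        · simp [hi, h']
    · have : l.length * (2 * ∑ k', (Function.update S k [] k').length + 1) ≤
        l.length * (2 * ∑ k, (S k).length + 1) := by gcongr
      simp only [List.length_cons]
      nlinarith

/-- The machine that runs `p` on the input on stack `inp`, empties all stacks and outputs
`ans v` where `v` is the last register value of `p`. -/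
noncomputable def toFinTM2 [DecidableEq K] [Fintype K] [Fintype σ] (inp : K) [Fintype (Γ inp)]
    (init : σ) (p : StackProg Γ σ) (ans : σ → Γ inp) : FinTM2 :=
  letI P : StackProg Γ σ :=
    seq p (seq (seqList ((Finset.univ.toList : List K).map clear)) (push inp ans))
  letI : Fintype (Lab P) := Fintype.ofFinite _
  { K := K
    k₀ := inp
    k₁ := inp
    Γ := Γ
    Λ := Option (Lab P)
    main := some (entry P)
    σ := σ × Bool
    initialState := (init, false)
    -- A halting configuration must have the initial register value, so the register is reset.
    m := fun l => Option.elim l (.load (fun _ => (init, false)) .halt) (code P some none) }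

theorem outputs_toFinTM2 [DecidableEq K] [Fintype K] [Fintype σ] (inp : K) [Fintype (Γ inp)]
    (init : σ) (p : StackProg Γ σ) (ans : σ → Γ inp) (w : List (Γ inp)) {v' S' t}
    (h : Run p init (Function.update (fun _ => []) inp w) v' S' t) :
    Nonempty (TM2OutputsInTime (toFinTM2 inp init p ans) w (some [ans v'])
      ((2 * Fintype.card K + 1) * (w.length + t) + Fintype.card K + 3)) := by
  obtain ⟨t₁, ht₁, h₁⟩ := run_clear_list (Finset.univ.toList : List K) v' S'
  have hsz := h.size_le
  have hup := sum_length_update (fun k => ([] : List (Γ k))) inp w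
  simp only [List.length_nil, Finset.sum_const_zero] at hup
  have h₂ := h.seq (h₁.seq (Run.push inp ans v' _))
  obtain ⟨b, hb⟩ := h₂.steps (toFinTM2 inp init p ans).m some none (fun l => rfl) false
  have h₃ : Steps (toFinTM2 inp init p ans).m _ _ _ := hb.trans (.single (by
    simp only [TM2.step, toFinTM2, Option.elim, TM2.stepAux]; rfl))
  refine ⟨⟨⟨t + (t₁ + 1) + 1, ?_⟩, ?_⟩⟩
  · refine Eq.trans (congrArg _ (congrArg some ?_)) (Eq.trans h₃ (congrArg some ?_))
    · simp only [initList, toFinTM2]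
      congr 1
      funext k
      rcases eq_or_ne k inp with rfl | hk
      · simp; rfl
      · simp [hk]
    · simp only [haltList, toFinTM2]
      congr 1
      funext k
      rcases eq_or_ne k inp with rfl | hk
      · simp; rfl
      · simp [hk]
  · simp only [Finset.length_toList, Finset.card_univ] at ht₁
    have : Fintype.card K * (2 * ∑ k, (S' k).length + 1) ≤ Fintype.card K * (2 * (w.length + t) + 1) := by
      gcongr
      omega
    nlinarith

/-- A program that decides a problem within `p(L) * b ^ k` steps shows that the problem is solvable
in time `O*(b ^ k)`. -/
theorem solvableInOStar [DecidableEq K] [Fintype K] [Fintype σ] (inp : K) [Fintype (Γ inp)]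
    (e : Γ inp ≃ Bool) (init : σ) (prog : StackProg Γ σ) (ans : σ → Γ inp)
    (P : ParamProblem) {b : ℝ} (hb : 1 ≤ b) (C d : ℕ)
    (h : ∀ x : P.Inst, ∃ v' S', ∃ t : ℕ, (t : ℝ) ≤ C * ((P.encode x).length + 1) ^ d * b ^ P.param x ∧
      Run prog init (Function.update (fun _ => []) inp ((P.encode x).map e.symm)) v' S' t ∧
      (e (ans v') = true ↔ P.IsYes x)) :
    P.SolvableInOStar b := by
  classical
  refine ⟨⟨toFinTM2 inp init prog ans, e, e⟩,
    -- The degree `d + 1` instead of `d` absorbs the input length in the cost of the cleanup.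
    Polynomial.C ((2 * Fintype.card K + 1) * C + (3 * Fintype.card K + 4)) *
      (Polynomial.X + 1) ^ (d + 1), fun x => ?_⟩
  obtain ⟨v', S', t, ht, hr, ha⟩ := h x
  refine ⟨(2 * Fintype.card K + 1) * ((P.encode x).length + t) + Fintype.card K + 3, ?_, ?_⟩
  rotate_left
  · have := outputs_toFinTM2 inp init prog ans _ hr
    have h2 : [ans v'] = (Computability.encodeBool (decide (P.IsYes x))).map e.symm := by
      change _ = [e.symm _]
      rw [List.cons.injEq, Equiv.eq_symm_apply, Bool.eq_iff_iff, ha]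
      simp
    rw [List.length_map] at this
    exact (congrArg (fun z : List (Γ inp) => Nonempty
      (TM2OutputsInTime (toFinTM2 inp init prog ans) _ (some z) _)) h2).mp this
  · have hk : (1 : ℝ) ≤ b ^ P.param x := one_le_pow₀ hb
    simp only [Polynomial.eval_mul, Polynomial.eval_C, Polynomial.eval_pow,
      Polynomial.eval_add, Polynomial.eval_X, Polynomial.eval_one]
    push_cast
    set L : ℝ := ((P.encode x).length : ℝ)
    set N : ℝ := (Fintype.card K : ℝ)
    have hN : 0 ≤ N := Nat.cast_nonneg _
    have hL : 0 ≤ L := Nat.cast_nonneg _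
    have hC : (0 : ℝ) ≤ C := Nat.cast_nonneg _
    set B := b ^ P.param x
    have h1 : (1 : ℝ) ≤ (L + 1) ^ d := one_le_pow₀ (by linarith)
    have e1 : (L + 1) ≤ (L + 1) ^ (d + 1) * B := by
      rw [pow_succ]
      have : (L + 1) * 1 ≤ ((L + 1) ^ d * (L + 1)) * B := by
        apply mul_le_mul _ hk zero_le_one (by positivity)
        nlinarith
      linarith
    have e2 : (L + 1) ^ d * B ≤ (L + 1) ^ (d + 1) * B := by
      gcongr
      · linarith
      · omega
    have e3 : (t : ℝ) ≤ C * ((L + 1) ^ (d + 1) * B) := by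
      refine ht.trans ?_
      rw [mul_assoc]
      gcongr
    set Q := (L + 1) ^ (d + 1) * B
    have e4 : 1 ≤ Q := by linarith
    have : (2 * N + 1) * (L + t) ≤ (2 * N + 1) * (Q + C * Q) := by
      gcongr
      linarith
    have e5 : N ≤ N * Q := by nlinarith
    rw [mul_assoc]
    change _ ≤ _ * Q
    nlinarith

end StackProg

/-! ### The memory of the machine and loops over all vertices. -/

namespace Branching

/-- What the machine stores about one vertex. Relative to a partial tuple of vertices, `adj i` says
whether the vertex is adjacent to the `i`-th entry and `mark i` whether it is the `i`-th entry. -/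
@[ext]
structure Cell (q m : ℕ) where
  inX : Bool
  lst : Fin q → Bool
  done : Bool
  adj : Fin m → Bool
  mark : Fin m → Bool
  asg : Option (Fin q)

variable {q m n : ℕ}

instance : Finite (Cell q m) :=
  Finite.of_injective (fun c : Cell q m => (c.inX, c.lst, c.done, c.adj, c.mark, c.asg))
    fun c d h => by cases c; cases d; simp_all

instance : Inhabited (Cell q m) :=
  ⟨⟨false, fun _ => false, false, fun _ => false, fun _ => false, none⟩⟩

/-- The control register of the machine. -/
structure Reg (q m : ℕ) where
  cell : Cell q m
  bit : Bool × Bool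
  flag : Bool
  col : Option (Fin q)
  tau : Fin m → Cell q m

instance : Finite (Reg q m) :=
  Finite.of_injective (fun c : Reg q m => (c.cell, c.bit, c.flag, c.col, c.tau))
    fun c d h => by cases c; cases d; simp_all

instance : Inhabited (Reg q m) := ⟨⟨default, default, false, none, default⟩⟩

/-- The stacks of the machine. -/
inductive Stk (m : ℕ) : Type
  | inp | cnt | v | v2 | w | w2
  | mat (i : Fin m)
  | mat2 (i : Fin m)
deriving DecidableEq

instance : Finite (Stk m) :=
  Finite.of_surjective (fun x : Fin 6 ⊕ Fin m ⊕ Fin m => match x with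
    | .inl 0 => .inp
    | .inl 1 => .cnt
    | .inl 2 => .v
    | .inl 3 => .v2
    | .inl 4 => .w
    | .inl 5 => .w2
    | .inr (.inl i) => .mat i
    | .inr (.inr i) => .mat2 i) fun k => by
  cases k with
  | inp => exact ⟨.inl 0, rfl⟩
  | cnt => exact ⟨.inl 1, rfl⟩
  | v => exact ⟨.inl 2, rfl⟩
  | v2 => exact ⟨.inl 3, rfl⟩
  | w => exact ⟨.inl 4, rfl⟩
  | w2 => exact ⟨.inl 5, rfl⟩
  | mat i => exact ⟨.inr (.inl i), rfl⟩
  | mat2 i => exact ⟨.inr (.inr i), rfl⟩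

/-- The stack alphabets. -/
abbrev Alph (q : ℕ) : Stk m → Type
  | .inp => Bool
  | .cnt => Unit
  | .v | .v2 => Cell q m
  | .w | .w2 => Option (Fin q)
  | .mat _ | .mat2 _ => Bool × Bool

/-- The register and the contents of all stacks. -/
structure Mem (q m : ℕ) where
  reg : Reg q m
  inp : List Bool
  cnt : List Unit
  v : List (Cell q m)
  v2 : List (Cell q m)
  w : List (Option (Fin q))
  w2 : List (Option (Fin q))
  mat : Fin m → List (Bool × Bool)
  mat2 : Fin m → List (Bool × Bool)

/-- The stacks as a dependent function. -/
def Mem.stk (s : Mem q m) : ∀ k : Stk m, List (Alph q k)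
  | .inp => s.inp
  | .cnt => s.cnt
  | .v => s.v
  | .v2 => s.v2
  | .w => s.w
  | .w2 => s.w2
  | .mat i => s.mat i
  | .mat2 i => s.mat2 i

/-- Replace the contents of one stack. -/
def Mem.set (s : Mem q m) : ∀ k : Stk m, List (Alph q k) → Mem q m
  | .inp, l => { s with inp := l }
  | .cnt, l => { s with cnt := l }
  | .v, l => { s with v := l }
  | .v2, l => { s with v2 := l }
  | .w, l => { s with w := l }
  | .w2, l => { s with w2 := l }
  | .mat i, l => { s with mat := Function.update s.mat i l }
  | .mat2 i, l => { s with mat2 := Function.update s.mat2 i l }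

theorem Mem.set_reg (s : Mem q m) (k : Stk m) (l : List (Alph q k)) : (s.set k l).reg = s.reg := by
  cases k <;> rfl

theorem Mem.stk_set (s : Mem q m) (k : Stk m) (l : List (Alph q k)) :
    (s.set k l).stk = Function.update s.stk k l := by
  funext k'
  rcases eq_or_ne k' k with rfl | h
  · rw [Function.update_self]
    cases k' <;> first | rfl | exact Function.update_self ..
  · rw [Function.update_of_ne h]
    cases k <;> cases k' <;> first | rfl | exact absurd rfl h | skip
    all_goals
      exact Function.update_of_ne (fun e => h (by rw [e])) _ _

/-- Programs of the machine. -/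
abbrev Prg (q m : ℕ) := StackProg (Alph q (m := m)) (Reg q m)

/-- `Does p s s' t`: the program `p` leads from `s` to `s'` within `t` steps. -/
def Does (p : Prg q m) (s s' : Mem q m) (t : ℕ) : Prop :=
  ∃ t' ≤ t, StackProg.Run p s.reg s.stk s'.reg s'.stk t'

theorem Does.mono {p : Prg q m} {s s' : Mem q m} {t t' : ℕ} (h : Does p s s' t) (ht : t ≤ t') :
    Does p s s' t' :=
  let ⟨a, ha, h⟩ := h; ⟨a, ha.trans ht, h⟩

theorem Does.seq {p p' : Prg q m} {s s' s'' : Mem q m} {t t' : ℕ} (h : Does p s s' t)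
    (h' : Does p' s' s'' t') : Does (.seq p p') s s'' (t + t') :=
  let ⟨a, ha, h⟩ := h; let ⟨b, hb, h'⟩ := h'; ⟨a + b, by omega, h.seq h'⟩

theorem does_push (k : Stk m) (f : Reg q m → Alph q k) (s : Mem q m) :
    Does (.push k f) s (s.set k (f s.reg :: s.stk k)) 1 :=
  ⟨1, le_rfl, by rw [Mem.set_reg, Mem.stk_set]; exact .push ..⟩

theorem does_pop (k : Stk m) (f : Reg q m → Option (Alph q k) → Reg q m) (s : Mem q m) :
    Does (.pop k f) s ({ s with reg := f s.reg (s.stk k).head? }.set k (s.stk k).tail) 1 :=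
  ⟨1, le_rfl, by rw [Mem.set_reg, Mem.stk_set]; exact .pop k f s.reg s.stk⟩

theorem does_load (f : Reg q m → Reg q m) (s : Mem q m) :
    Does (.load f) s { s with reg := f s.reg } 1 :=
  ⟨1, le_rfl, .load f s.reg s.stk⟩

theorem Does.ite_true {k c} {p p' : Prg q m} {s s' : Mem q m} {t : ℕ}
    (hc : c s.reg (s.stk k).head? = true) (h : Does p s s' t) : Does (.ite k c p p') s s' (t + 1) :=
  let ⟨a, ha, h⟩ := h; ⟨1 + a, by omega, .ite_true hc h⟩

theorem Does.ite_false {k c} {p p' : Prg q m} {s s' : Mem q m} {t : ℕ}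
    (hc : c s.reg (s.stk k).head? = false) (h : Does p' s s' t) : Does (.ite k c p p') s s' (t + 1) :=
  let ⟨a, ha, h⟩ := h; ⟨1 + a, by omega, .ite_false hc h⟩

/-- The loop invariant is an explicit family of memories, one for each round. Every later loop is
verified by writing down this family. -/
theorem does_while {k c} {p : Prg q m} (N : ℕ) (t : ℕ) (s : ℕ → Mem q m)
    (hc : ∀ j < N, c (s j).reg ((s j).stk k).head? = true)
    (hN : c (s N).reg ((s N).stk k).head? = false)
    (h : ∀ j < N, Does p (s j) (s (j + 1)) t) :
    Does (.while k c p) (s 0) (s N) (N * (t + 1) + 1) := by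
  induction N generalizing s with
  | zero => exact ⟨1, by omega, .while_false hN⟩
  | succ N ih =>
    obtain ⟨a, ha, h₁⟩ := h 0 (by omega)
    obtain ⟨b, hb, h₂⟩ := ih (fun j => s (j + 1)) (fun j hj => hc _ (by omega)) hN
      (fun j hj => h _ (by omega))
    exact ⟨1 + a + b, by rw [add_mul]; omega, .while_true (hc 0 (by omega)) h₁ h₂⟩

/-- Run `p` as long as the stack `k` is nonempty. -/
def whileNE (k : Stk m) (p : Prg q m) : Prg q m := .while k (fun _ o => o.isSome) p

/-- Do nothing. -/
def skip : Prg q m := .load id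

theorem Does.congr {p : Prg q m} {s s' s'' : Mem q m} {t : ℕ} (h : Does p s s' t) (e : s' = s'') :
    Does p s s'' t := e ▸ h

theorem does_pop_inp (f : Reg q m → Option Bool → Reg q m) (s : Mem q m) :
    Does (.pop .inp f) s { s with reg := f s.reg s.inp.head?, inp := s.inp.tail } 1 := does_pop .inp f s

theorem does_pop_w (f : Reg q m → Option (Option (Fin q)) → Reg q m) (s : Mem q m) :
    Does (.pop .w f) s { s with reg := f s.reg s.w.head?, w := s.w.tail } 1 := does_pop .w f s

theorem does_pop_w2 (f : Reg q m → Option (Option (Fin q)) → Reg q m) (s : Mem q m) :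
    Does (.pop .w2 f) s { s with reg := f s.reg s.w2.head?, w2 := s.w2.tail } 1 := does_pop .w2 f s

theorem does_pop_mat (i : Fin m) (f : Reg q m → Option (Bool × Bool) → Reg q m) (s : Mem q m) :
    Does (.pop (.mat i) f) s { s with
      reg := f s.reg (s.mat i).head?
      mat := Function.update s.mat i (s.mat i).tail } 1 := does_pop (.mat i) f s

theorem does_pop_mat2 (i : Fin m) (f : Reg q m → Option (Bool × Bool) → Reg q m) (s : Mem q m) :
    Does (.pop (.mat2 i) f) s { s with
      reg := f s.reg (s.mat2 i).head?
      mat2 := Function.update s.mat2 i (s.mat2 i).tail } 1 := does_pop (.mat2 i) f s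

theorem does_push_w (f : Reg q m → Option (Fin q)) (s : Mem q m) :
    Does (.push .w f) s { s with w := f s.reg :: s.w } 1 := does_push .w f s

theorem does_push_w2 (f : Reg q m → Option (Fin q)) (s : Mem q m) :
    Does (.push .w2 f) s { s with w2 := f s.reg :: s.w2 } 1 := does_push .w2 f s

theorem does_push_mat (i : Fin m) (f : Reg q m → Bool × Bool) (s : Mem q m) :
    Does (.push (.mat i) f) s { s with mat := Function.update s.mat i (f s.reg :: s.mat i) } 1 :=
  does_push (.mat i) f s

theorem does_push_mat2 (i : Fin m) (f : Reg q m → Bool × Bool) (s : Mem q m) :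
    Does (.push (.mat2 i) f) s { s with mat2 := Function.update s.mat2 i (f s.reg :: s.mat2 i) } 1 :=
  does_push (.mat2 i) f s

theorem does_skip (s : Mem q m) : Does skip s s 1 := does_load id s

/-- Move all cells from `v` to `v2`, running `body` on each of them. -/
def unloadCells (body : Prg q m) : Prg q m :=
  whileNE .v (.seq (.pop .v fun r o => { r with cell := o.getD (default : Cell q m) })
    (.seq body (.seq (.push .v2 fun r => r.cell) (.load fun r => { r with cell := default }))))

/-- Move all cells back from `v2` to `v`. -/
def reloadCells : Prg q m :=
  whileNE .v2 (.seq (.pop .v2 fun r o => { r with cell := o.getD (default : Cell q m) })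
    (.seq (.push .v fun r => r.cell) (.load fun r => { r with cell := default })))

/-- Run `body` once for every vertex, with the cell of the vertex in the register. -/
def forCells (body : Prg q m) : Prg q m := .seq (unloadCells body) reloadCells

/-- The list of the values of a function on `Fin n`. -/
def block {α : Type} (a : Fin n → α) : List α := (List.finRange n).map a

@[simp] theorem length_block {α : Type} (a : Fin n → α) : (block a).length = n := by simp [block]

theorem drop_block {α : Type} (a : Fin n → α) (u : Fin n) :
    (block a).drop u = a u :: (block a).drop (u + 1) := by
  rw [List.drop_eq_getElem_cons (by simp)]
  simp [block]

theorem take_block {α : Type} (a : Fin n → α) (u : Fin n) :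
    (block a).take (u + 1) = (block a).take u ++ [a u] := by
  rw [List.take_add_one, List.getElem?_eq_getElem (by simp)]
  simp [block]

/-- The memory `s` with prescribed cell register and vertex stacks. -/
def Mem.cells (s : Mem q m) (c : Cell q m) (l l2 : List (Cell q m)) : Mem q m :=
  { s with reg := { s.reg with cell := c }, v := l, v2 := l2 }

/-- The family `s` describes the rest of the memory, which `body` may change from vertex to vertex.
After `j` rounds the first `j` new cells lie in reverse order on `v2`. -/
theorem does_unloadCells {body : Prg q m} (f g : Fin n → Cell q m) (s : ℕ → Mem q m) (t : ℕ)
    (h : ∀ (u : Fin n) (l l2), Does body ((s u).cells (f u) l l2) ((s (u + 1)).cells (g u) l l2) t) :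
    Does (unloadCells body) ((s 0).cells default (block f) [])
      ((s n).cells default [] (block g).reverse) (n * (t + 4) + 1) := by
  have h1 := does_while (k := .v) (c := fun _ o => o.isSome)
    (p := .seq (.pop .v fun r o => { r with cell := o.getD (default : Cell q m) })
    (.seq body (.seq (.push .v2 fun r => r.cell)
      (.load fun r => { r with cell := default })))) n (1 + (t + (1 + 1)))
    (fun j => (s j).cells default ((block f).drop j) ((block g).take j).reverse)
    (fun j hj => by
      change ((block f).drop j).head?.isSome = true
      rw [drop_block f ⟨j, hj⟩]; rfl)
    (by
      change ((block f).drop n).head?.isSome = false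
      rw [List.drop_of_length_le (by simp)]; rfl)
    (fun j hj => by
      refine Does.seq (does_pop _ _ _) (Does.seq (s' := (s (j + 1)).cells (g ⟨j, hj⟩)
        ((block f).drop (j + 1)) ((block g).take j).reverse) ?_ ?_)
      · have := h ⟨j, hj⟩ ((block f).drop (j + 1)) ((block g).take j).reverse
        convert this using 1
        simp only [Mem.stk, Mem.cells, Mem.set]
        rw [drop_block f ⟨j, hj⟩]
        rfl
      · convert (does_push .v2 (fun r : Reg q m => r.cell) ((s (j + 1)).cells (g ⟨j, hj⟩)
          ((block f).drop (j + 1)) ((block g).take j).reverse)).seq (does_load _ _) using 1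
        rw [take_block g ⟨j, hj⟩, List.reverse_append]
        rfl)
  simp only [List.drop_zero, List.take_zero, List.reverse_nil] at h1
  rw [List.drop_of_length_le (length_block f).le, List.take_of_length_le (length_block g).le] at h1
  refine Does.mono h1 (le_of_eq ?_)
  ring

theorem does_reloadCells (g : Fin n → Cell q m) (s : Mem q m) :
    Does reloadCells (s.cells default [] (block g).reverse) (s.cells default (block g) [])
      (n * 4 + 1) := by
  have h2 := does_while (k := .v2) (c := fun _ o => o.isSome)
    (p := .seq (.pop .v2 fun r o => { r with cell := o.getD (default : Cell q m) })
    (.seq (.push .v fun r => r.cell)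
      (.load fun r => { r with cell := default }))) n (1 + (1 + 1))
    (fun j => s.cells default ((block g).drop (n - j)) ((block g).take (n - j)).reverse)
    (fun j hj => by
      change (((block g).take (n - j)).reverse).head?.isSome = true
      have := take_block g ⟨n - j - 1, by omega⟩
      simp only [show n - j - 1 + 1 = n - j by omega] at this
      rw [this]; simp)
    (by
      change (((block g).take (n - n)).reverse).head?.isSome = false
      simp)
    (fun j hj => by
      refine Does.seq (does_pop _ _ _) ?_
      convert (does_push .v (fun r : Reg q m => r.cell) _).seq (does_load _ _) using 1
      have := take_block g ⟨n - j - 1, by omega⟩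
      have h3 := drop_block g ⟨n - j - 1, by omega⟩
      simp only [show n - j - 1 + 1 = n - j by omega] at this h3
      simp only [Mem.stk, Mem.cells, Mem.set]
      rw [this, show n - (j + 1) = n - j - 1 by omega, h3, List.reverse_append]
      rfl)
  simp only [Nat.sub_zero, Nat.sub_self, List.drop_zero, List.take_zero, List.reverse_nil] at h2
  rw [List.drop_of_length_le (length_block g).le, List.take_of_length_le (length_block g).le] at h2
  exact h2

theorem does_forCells {body : Prg q m} (f g : Fin n → Cell q m) (s : ℕ → Mem q m) (t : ℕ)
    (h : ∀ (u : Fin n) (l l2), Does body ((s u).cells (f u) l l2) ((s (u + 1)).cells (g u) l l2) t) :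
    Does (forCells body) ((s 0).cells default (block f) []) ((s n).cells default (block g) [])
      ((n + 1) * (t + 8)) := by
  refine ((does_unloadCells f g s t h).seq (does_reloadCells g (s n))).mono ?_
  ring_nf
  omega

end Branching

/-! ### Storing a tuple of vertices in the cells. -/

namespace Branching

variable {q m n : ℕ}

/-- The instance that the machine works on. -/
structure Data (q n : ℕ) where
  A : Fin n → Fin n → Bool
  X : Fin n → Bool
  lst : Fin n → Fin q → Bool

/-- The cell of the vertex `u`, relative to a partial tuple `v` and a partial assignment `a`. -/
def vcell (D : Data q n) (v : Fin m → Option (Fin n)) (a : Fin n → Option (Fin q)) (u : Fin n) :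
    Cell q m where
  inX := D.X u
  lst := D.lst u
  done := true
  adj i := (v i).elim false fun j => D.A j u
  mark i := (v i).elim false fun j => decide (u = j)
  asg := a u

/-- The cells of the entries of a partial tuple. -/
def tau (D : Data q n) (v : Fin m → Option (Fin n)) (a : Fin n → Option (Fin q)) (i : Fin m) :
    Cell q m := (v i).elim default fun j => vcell D v a j

/-- Row `j` of the adjacency matrix, with a marker at the diagonal. -/
def row (D : Data q n) (j u : Fin n) : Bool × Bool := (D.A j u, decide (u = j))

/-- Overwrite the information about the `i`-th entry of the tuple. -/
def Cell.setLayer (c : Cell q m) (i : Fin m) (b : Bool × Bool) : Cell q m :=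
  { c with adj := Function.update c.adj i b.1, mark := Function.update c.mark i b.2 }

theorem vcell_update_some (D : Data q n) (v : Fin m → Option (Fin n)) (a) (i : Fin m) (j u : Fin n) :
    (vcell D v a u).setLayer i (row D j u) = vcell D (Function.update v i (some j)) a u := by
  ext k
  any_goals rfl
  all_goals
    rcases eq_or_ne k i with rfl | h
    · simp [Cell.setLayer, vcell, row]
    · simp [Cell.setLayer, vcell, h]

theorem vcell_update_none (D : Data q n) (v : Fin m → Option (Fin n)) (a) (i : Fin m) (u : Fin n) :
    (vcell D v a u).setLayer i (false, false) = vcell D (Function.update v i none) a u := by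
  ext k
  any_goals rfl
  all_goals
    rcases eq_or_ne k i with rfl | h
    · simp [Cell.setLayer, vcell]
    · simp [Cell.setLayer, vcell, h]

/-- The color that the current vertex gets when the `i`-th entry of the tuple is assigned `δ i`. -/
def childAsg (δ : Fin m → Option (Fin q)) (c : Cell q m) : Option (Fin q) :=
  ((List.finRange m).findSome? fun i => if c.mark i then δ i else none).or c.asg

/-- The assignments that replace `a` when the tuple `v` is processed. -/
noncomputable def step (br : (Fin m → Cell q m) → (Fin m → Option (Fin q)) → Bool) (D : Data q n)
    (v : Fin m → Option (Fin n)) (a : Fin n → Option (Fin q)) : List (Fin n → Option (Fin q)) :=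
  ((Finset.univ : Finset (Fin m → Option (Fin q))).toList.filter (br (tau D v a))).map
    fun δ u => childAsg δ (vcell D v a u)

/-- The word that represents a list of assignments. -/
def flat {α : Type} (W : List (Fin n → α)) : List α := W.flatMap block

/-- Read the next row entry of the `i`-th matrix copy into the current cell. -/
def overlay (i : Fin m) : Prg q m :=
  .seq (.pop (.mat i) fun r o => { r with bit := o.getD (default : Bool × Bool) })
    (.seq (.push (.mat2 i) fun r => r.bit)
      (.load fun r => { r with cell := r.cell.setLayer i r.bit, bit := default }))

/-- The loop over the vertices consumes exactly one row of the `i`-th matrix copy. The diagonal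
marker in that row makes vertex `j` recognize itself as the new entry. The row is saved in reverse
on `mat2 i`, from where `restore` brings it back. -/
theorem does_overlay (D : Data q n) (v : Fin m → Option (Fin n)) (a) (i : Fin m) (j : Fin n)
    (S : Mem q m) (hb : S.reg.bit = default) (l : List (Bool × Bool))
    (hl : S.mat i = block (row D j) ++ l) :
    Does (forCells (overlay i)) (S.cells default (block (vcell D v a)) [])
      ({ S with
        mat := Function.update S.mat i l
        mat2 := Function.update S.mat2 i ((block (row D j)).reverse ++ S.mat2 i) }.cells default
          (block (vcell D (Function.update v i (some j)) a)) []) ((n + 1) * 11) := by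
  have := does_forCells (body := overlay i) (vcell D v a) (vcell D (Function.update v i (some j)) a)
    (fun k => { S with
        mat := Function.update S.mat i ((block (row D j)).drop k ++ l)
        mat2 := Function.update S.mat2 i (((block (row D j)).take k).reverse ++ S.mat2 i) }) 3
    (fun u l1 l2 => by
      refine ((does_pop_mat _ _ _).seq ((does_push_mat2 _ _ _).seq (does_load _ _))).congr ?_
      simp only [Mem.cells, Function.update_self, Function.update_idem]
      rw [drop_block, take_block, ← vcell_update_some]
      simp [hb, List.reverse_append])
  convert this using 1
  · simp only [List.drop_zero, List.take_zero, List.reverse_nil, List.nil_append, ← hl]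
    rw [Function.update_eq_self, Function.update_eq_self]
  · rw [List.drop_of_length_le (by simp), List.take_of_length_le (by simp)]
    rfl

/-- Put the `i`-th matrix copy back in place. -/
def restore (i : Fin m) : Prg q m :=
  whileNE (.mat2 i) (.seq (.pop (.mat2 i) fun r o => { r with bit := o.getD (default : Bool × Bool) })
    (.seq (.push (.mat i) fun r => r.bit) (.load fun r => { r with bit := default })))

theorem does_restore (i : Fin m) (S : Mem q m) (hb : S.reg.bit = default) (l l2 : List (Bool × Bool))
    (h : S.mat i = l) (h2 : S.mat2 i = l2) :
    Does (restore i) S { S with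
        mat := Function.update S.mat i (l2.reverse ++ l)
        mat2 := Function.update S.mat2 i [] } (4 * l2.length + 1) := by
  subst h h2
  have := does_while (k := .mat2 i) (c := fun _ o => o.isSome)
    (p := .seq (.pop (.mat2 i) fun r o => { r with bit := o.getD (default : Bool × Bool) })
    (.seq (.push (.mat i) fun r => r.bit) (.load fun r => { r with bit := default }))) (S.mat2 i).length
    (1 + (1 + 1))
    (fun j => { S with
        mat := Function.update S.mat i (((S.mat2 i).take j).reverse ++ S.mat i)
        mat2 := Function.update S.mat2 i ((S.mat2 i).drop j) })
    (fun j hj => by simp [Mem.stk, hj])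
    (by simp [Mem.stk])
    (fun j hj => by
      refine ((does_pop_mat2 _ _ _).seq ((does_push_mat _ _ _).seq (does_load _ _))).congr ?_
      have hreg : ({ S.reg with bit := default } : Reg q m) = S.reg := by rw [← hb]
      simp only [List.head?_drop, List.getElem?_eq_getElem hj, Option.getD_some, Function.update_self,
        Function.update_idem, List.tail_drop, hreg, List.take_add_one, Option.toList_some,
        List.reverse_append]
      rfl)
  change Does (restore i) _ _ _ at this
  refine Does.mono ?_ (t := (S.mat2 i).length * (1 + (1 + 1) + 1) + 1) (by omega)
  convert this using 1
  · simp
  · simp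

end Branching

/-! ### Replacing the assignments for a fixed tuple. -/

namespace Branching

variable {q m n : ℕ}

/-- Read the next assignment into the cells and record the cells of the tuple entries. -/
def readAsg : Prg q m :=
  .seq (.pop .w fun r o => { r with cell := { r.cell with asg := o.getD (none : Option (Fin q)) } })
    (.load fun r => { r with tau := fun i => if r.cell.mark i then r.cell else r.tau i })

theorem does_readAsg (D : Data q n) (v : Fin m → Option (Fin n)) (a : Fin n → Option (Fin q))
    (S : Mem q m) (ht : S.reg.tau = default) (l : List (Option (Fin q))) :
    Does (forCells readAsg)
      ({ S with w := block a ++ l }.cells default (block (vcell D v fun _ => none)) [])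
      ({ S with w := l, reg := { S.reg with tau := tau D v a } }.cells default
          (block (vcell D v a)) []) ((n + 1) * 10) := by
  have := does_forCells (body := readAsg) (vcell D v fun _ => none) (vcell D v a)
    (fun k => { S with
        w := (block a).drop k ++ l
        -- An entry of the tuple is recorded when the loop passes its vertex, so after `k` rounds
        -- exactly the entries below `k` are known.
        reg := { S.reg with tau := fun i => (v i).elim default fun j =>
          if j.1 < k then vcell D v a j else default } }) 2
    (fun u l1 l2 => by
      refine ((does_pop_w _ _).seq (does_load _ _)).congr ?_
      simp only [Mem.cells]
      rw [drop_block]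
      congr 2
      funext i
      rcases hv : v i with _ | j
      · simp [vcell, hv]
      · rcases eq_or_ne u j with rfl | h
        · simp [vcell, hv]
        · have : (j : ℕ) ≠ u := fun e => h (Fin.ext e.symm)
          simp [vcell, hv, h, Nat.le_iff_lt_or_eq, this])
  convert this using 1
  · have : (fun i => (v i).elim default fun j => if j.1 < 0 then vcell D v a j else default) =
        S.reg.tau := by
      rw [ht]; funext i; cases v i <;> simp
    rw [this]; rfl
  · have : (fun i => (v i).elim default fun j => if j.1 < n then vcell D v a j else default) =
        tau D v a := by
      funext i; simp [tau]
    rw [this, List.drop_of_length_le (by simp)]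
    rfl

/-- Write the assignment obtained from the current one by `δ`. -/
def writeChild (δ : Fin m → Option (Fin q)) : Prg q m := .push .w2 fun r => childAsg δ r.cell

theorem does_writeChild (δ : Fin m → Option (Fin q)) (f : Fin n → Cell q m)
    (S : Mem q m) (l : List (Option (Fin q))) :
    Does (forCells (writeChild δ)) ({ S with w2 := l }.cells default (block f) [])
      ({ S with w2 := (block fun u => childAsg δ (f u)).reverse ++ l }.cells default (block f) [])
      ((n + 1) * 9) := by
  have := does_forCells (body := writeChild δ) f f
    (fun k => { S with w2 := ((block fun u => childAsg δ (f u)).take k).reverse ++ l }) 1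
    (fun u l1 l2 => by
      refine (does_push_w2 _ _).congr ?_
      simp only [Mem.cells]
      rw [take_block, List.reverse_append]
      rfl)
  convert this using 1
  · simp
  · rw [List.take_of_length_le (l := block _) (by simp)]

/-- Write all assignments that replace the current one. -/
def writeChildren (br : (Fin m → Cell q m) → (Fin m → Option (Fin q)) → Bool)
    (Δ : List (Fin m → Option (Fin q))) : Prg q m :=
  StackProg.seqList (Δ.map fun δ => .ite .inp (fun r _ => br r.tau δ) (forCells (writeChild δ)) skip)

theorem does_writeChildren (br : (Fin m → Cell q m) → (Fin m → Option (Fin q)) → Bool)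
    (Δ : List (Fin m → Option (Fin q))) (f : Fin n → Cell q m) (S : Mem q m)
    (l : List (Option (Fin q))) :
    Does (writeChildren br Δ) ({ S with w2 := l }.cells default (block f) [])
      ({ S with w2 := (flat ((Δ.filter (br S.reg.tau)).map
        fun δ u => childAsg δ (f u))).reverse ++ l }.cells default (block f) [])
      (Δ.length * ((n + 1) * 10) + 1) := by
  induction Δ generalizing l with
  | nil => exact (does_skip _).mono (by simp)
  | cons δ Δ ih =>
    by_cases hb : br S.reg.tau δ
    · have h1 := Does.ite_true (k := .inp) (c := fun r _ => br r.tau δ) (p' := skip)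
        (s := { S with w2 := l }.cells default (block f) []) hb
        (does_writeChild δ f S l)
      refine ((h1.seq (ih _)).congr ?_).mono ?_
      · simp [hb, flat]
      · simp only [List.length_cons]; rw [add_mul (Δ.length)]; omega
    · have h1 := Does.ite_false (k := .inp) (c := fun r _ => br r.tau δ)
        (p := forCells (writeChild δ)) (s := { S with w2 := l }.cells default (block f) [])
        (eq_false_of_ne_true hb)
        (does_skip ({ S with w2 := l }.cells default (block f) []))
      refine ((h1.seq (ih _)).congr ?_).mono ?_
      · simp [hb]
      · simp only [List.length_cons]; rw [add_mul (Δ.length)]; omega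

/-- Remove the assignment from the cells. -/
def clearAsg : Prg q m := .load fun r => { r with cell := { r.cell with asg := none } }

theorem does_clearAsg (D : Data q n) (v : Fin m → Option (Fin n)) (a : Fin n → Option (Fin q))
    (S : Mem q m) :
    Does (forCells clearAsg) (S.cells default (block (vcell D v a)) [])
      (S.cells default (block (vcell D v fun _ => none)) []) ((n + 1) * 9) :=
  does_forCells (body := clearAsg) (vcell D v a) (vcell D v fun _ => none) (fun _ => S) 1
    fun _ _ _ => does_load _ _

/-- Replace the first assignment on the stack. -/
noncomputable def processOne (br : (Fin m → Cell q m) → (Fin m → Option (Fin q)) → Bool) : Prg q m :=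
  .seq (forCells readAsg) (.seq (writeChildren br Finset.univ.toList)
    (.seq (forCells clearAsg) (.load fun r => { r with tau := default })))

theorem does_processOne (br : (Fin m → Cell q m) → (Fin m → Option (Fin q)) → Bool) (D : Data q n)
    (v : Fin m → Option (Fin n)) (a : Fin n → Option (Fin q))
    (S : Mem q m) (ht : S.reg.tau = default) (l l' : List (Option (Fin q))) :
    Does (processOne br)
      ({ S with w := block a ++ l, w2 := l' }.cells default (block (vcell D v fun _ => none)) [])
      ({ S with w := l, w2 := (flat (step br D v a)).reverse ++ l' }.cells default
        (block (vcell D v fun _ => none)) [])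
      ((Fintype.card (Fin m → Option (Fin q)) + 3) * ((n + 1) * 10)) := by
  have h1 := does_readAsg D v a { S with w2 := l' } ht l
  have h2 := does_writeChildren br Finset.univ.toList (vcell D v a)
    { S with w := l, reg := { S.reg with tau := tau D v a } } l'
  have h3 := does_clearAsg D v a { S with
    w := l
    reg := { S.reg with tau := tau D v a }
    w2 := (flat (step br D v a)).reverse ++ l' }
  refine ((h1.seq (h2.seq (h3.seq (does_load _ _)))).congr ?_).mono ?_
  · simp [Mem.cells, ht]
  · simp only [Finset.length_toList, Finset.card_univ]
    ring_nf; omega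

/-- Move the word on `w2` to `w`. -/
def swapBack : Prg q m :=
  whileNE .w2 (.seq (.pop .w2 fun r o => { r with col := o.getD (none : Option (Fin q)) })
    (.seq (.push .w fun r => r.col) (.load fun r => { r with col := none })))

theorem does_swapBack (S : Mem q m) (hb : S.reg.col = none) (l : List (Option (Fin q))) :
    Does swapBack { S with w := [], w2 := l.reverse } { S with w := l, w2 := [] }
      (4 * l.length + 1) := by
  have := does_while (k := .w2) (c := fun _ o => o.isSome)
    (p := .seq (.pop .w2 fun r o => { r with col := o.getD (none : Option (Fin q)) })
    (.seq (.push .w fun r => r.col) (.load fun r => { r with col := none }))) l.length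
    (1 + (1 + 1))
    (fun j => { S with w := (l.reverse.take j).reverse, w2 := l.reverse.drop j })
    (fun j hj => by simp [Mem.stk, hj])
    (by simp [Mem.stk])
    (fun j hj => by
      refine ((does_pop_w2 _ _).seq ((does_push_w _ _).seq (does_load _ _))).congr ?_
      have hreg : ({ S.reg with col := none } : Reg q m) = S.reg := by rw [← hb]
      have hj' : j < l.reverse.length := by simpa using hj
      simp only [List.head?_drop, List.getElem?_eq_getElem hj', Option.getD_some,
        List.tail_drop, hreg, List.take_add_one, Option.toList_some, List.reverse_append]
      rfl)
  change Does swapBack _ _ _ at this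
  refine Does.mono ?_ (t := l.length * (1 + (1 + 1) + 1) + 1) (by omega)
  convert this using 1
  · simp
  · have : l.reverse.take l.length = l.reverse := List.take_of_length_le (by simp)
    simp [this]

/-- Replace all assignments on the stack, for the tuple that is recorded in the cells. -/
noncomputable def processAll (br : (Fin m → Cell q m) → (Fin m → Option (Fin q)) → Bool) : Prg q m :=
  .seq (whileNE .w (processOne br)) swapBack

theorem flat_append {α : Type} (W W' : List (Fin n → α)) : flat (W ++ W') = flat W ++ flat W' :=
  List.flatMap_append

theorem length_flat {α : Type} (W : List (Fin n → α)) : (flat W).length = W.length * n := by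
  induction W with
  | nil => simp [flat]
  | cons a W ih =>
    have : flat (a :: W) = block a ++ flat W := rfl
    rw [this, List.length_append, ih, length_block, List.length_cons]; ring

/-- Since `n` is positive, each assignment is a nonempty word, so `w` is empty only when no
assignment is left to process. The output is collected in reverse on `w2` and turned around at the
end. -/
theorem does_processAll (hn : 0 < n) (br : (Fin m → Cell q m) → (Fin m → Option (Fin q)) → Bool)
    (D : Data q n) (v : Fin m → Option (Fin n)) (W : List (Fin n → Option (Fin q)))
    (S : Mem q m) (ht : S.reg.tau = default) (hc : S.reg.col = none) (N : ℕ) (hW : W.length ≤ N)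
    (hW' : (W.flatMap (step br D v)).length ≤ N) :
    Does (processAll br)
      ({ S with w := flat W, w2 := [] }.cells default (block (vcell D v fun _ => none)) [])
      ({ S with w := flat (W.flatMap (step br D v)), w2 := [] }.cells default
        (block (vcell D v fun _ => none)) [])
      ((Fintype.card (Fin m → Option (Fin q)) + 4) * ((n + 1) * 10) * (N + 1)) := by
  set T := (Fintype.card (Fin m → Option (Fin q)) + 3) * ((n + 1) * 10)
  have h1 := does_while (k := .w) (c := fun _ o => o.isSome) (p := processOne br) W.length T
    (fun j => { S with
      w := flat (W.drop j)
      w2 := (flat ((W.take j).flatMap (step br D v))).reverse }.cells default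
        (block (vcell D v fun _ => none)) [])
    (fun j hj => by
      change (flat (W.drop j)).head?.isSome = true
      rw [List.isSome_head?, ← List.length_pos_iff, length_flat]
      have : 0 < (W.drop j).length := by simpa using hj
      positivity)
    (by
      change (flat (W.drop W.length)).head?.isSome = false
      simp [flat])
    (fun j hj => by
      have := does_processOne br D v W[j] S ht (flat (W.drop (j + 1)))
        (flat ((W.take j).flatMap (step br D v))).reverse
      convert this using 2
      · rw [List.drop_eq_getElem_cons hj]; rfl
      · rw [List.take_add_one, List.getElem?_eq_getElem hj]
        simp only [Option.toList_some, List.flatMap_append, flat_append, List.reverse_append,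
          List.flatMap_singleton])
  have h2 := does_swapBack (S.cells default (block (vcell D v fun _ => none)) []) hc
    (flat (W.flatMap (step br D v)))
  refine Does.mono (t := W.length * (T + 1) + 1 + (4 * (flat (W.flatMap (step br D v))).length + 1)) ?_ ?_
  · refine Does.seq (s' := { S.cells default (block (vcell D v fun _ => none)) [] with
      w := [], w2 := (flat (W.flatMap (step br D v))).reverse }) ?_ h2
    rw [List.drop_length, List.take_length] at h1
    exact h1
  · rw [length_flat]
    have e1 : W.length * (T + 1) ≤ N * (T + 1) := by gcongr
    have e2 : (W.flatMap (step br D v)).length * n ≤ N * n := by gcongr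
    have e3 : (Fintype.card (Fin m → Option (Fin q)) + 4) * ((n + 1) * 10) = T + (n + 1) * 10 := by
      simp only [T]; ring
    rw [e3]
    nlinarith

end Branching

/-! ### Nested loops over all tuples. -/

namespace Branching

variable {q m n : ℕ}

/-- Forget the `i`-th entry of the tuple. -/
def clearLayer (i : Fin m) : Prg q m := .load fun r => { r with cell := r.cell.setLayer i (false, false) }

theorem does_clearLayer (D : Data q n) (v : Fin m → Option (Fin n)) (a : Fin n → Option (Fin q))
    (i : Fin m) (S : Mem q m) :
    Does (forCells (clearLayer i)) (S.cells default (block (vcell D v a)) [])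
      (S.cells default (block (vcell D (Function.update v i none) a)) []) ((n + 1) * 9) :=
  does_forCells (body := clearLayer i) (vcell D v a) (vcell D (Function.update v i none) a)
    (fun _ => S) 1 fun u _ _ => by rw [← vcell_update_none]; exact does_load _ _

/-- Process all ways to choose the entries `is` of the tuple. -/
noncomputable def nest (br : (Fin m → Cell q m) → (Fin m → Option (Fin q)) → Bool) :
    List (Fin m) → Prg q m
  | [] => processAll br
  | i :: is => .seq (whileNE (.mat i) (.seq (forCells (overlay i)) (nest br is)))
      (.seq (restore i) (forCells (clearLayer i)))

/-- All ways to choose the entries `is` of a partial tuple. -/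
def tuples : List (Fin m) → (Fin m → Option (Fin n)) → List (Fin m → Option (Fin n))
  | [], v => [v]
  | i :: is, v => (List.finRange n).flatMap fun j => tuples is (Function.update v i (some j))

/-- Process a list of tuples. -/
noncomputable def processTuples (br : (Fin m → Cell q m) → (Fin m → Option (Fin q)) → Bool)
    (D : Data q n) (W : List (Fin n → Option (Fin q))) (vs : List (Fin m → Option (Fin n))) :
    List (Fin n → Option (Fin q)) :=
  vs.foldl (fun W v => W.flatMap (step br D v)) W

/-- The matrix that the machine stores, as a word. -/
def matrixWord (D : Data q n) : List (Bool × Bool) := flat ((List.finRange n).map (row D))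

theorem length_matrixWord (D : Data q n) : (matrixWord D).length = n * n := by
  simp [matrixWord, length_flat]

/-- Each nested loop has its own matrix copy, whose rows serve as the loop counter. The branching
rule enters the time analysis only through the invariant `Good`, which survives every step and
bounds the number of assignments by `N`. -/
theorem does_nest (hn : 0 < n) (br : (Fin m → Cell q m) → (Fin m → Option (Fin q)) → Bool)
    (D : Data q n) (N : ℕ) (Good : List (Fin n → Option (Fin q)) → Prop)
    (hstep : ∀ W (v : Fin m → Option (Fin n)), Good W → Good (W.flatMap (step br D v)))
    (hlen : ∀ W, Good W → W.length ≤ N) (is : List (Fin m)) (his : is.Nodup)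
    (v : Fin m → Option (Fin n)) (hv : ∀ i ∈ is, v i = none) (W : List (Fin n → Option (Fin q)))
    (hW : Good W) (S : Mem q m) (hS : S.reg = default)
    (hM : ∀ i ∈ is, S.mat i = matrixWord D ∧ S.mat2 i = []) :
    Does (nest br is)
      ({ S with w := flat W, w2 := [] }.cells default (block (vcell D v fun _ => none)) [])
      ({ S with w := flat (processTuples br D W (tuples is v)), w2 := [] }.cells default
        (block (vcell D v fun _ => none)) [])
      (((Fintype.card (Fin m → Option (Fin q)) + 4) * 10 + 27 * is.length) *
        (n + 1) ^ (is.length + 1) * (N + 1)) := by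
  induction is generalizing v W S with
  | nil =>
    refine (does_processAll hn br D v W S (by rw [hS]; rfl) (by rw [hS]; rfl) N (hlen _ hW)
      (hlen _ (hstep _ _ hW))).mono (le_of_eq ?_)
    simp only [List.length_nil]
    ring
  | cons i is ih =>
    have hgood : ∀ (vs : List (Fin m → Option (Fin n))) W, Good W → Good (processTuples br D W vs) := by
      intro vs
      induction vs with
      | nil => exact fun W h => h
      | cons v vs ih => exact fun W h => ih _ (hstep _ _ h)
    obtain ⟨hi, his⟩ := List.nodup_cons.1 his
    set T := ((Fintype.card (Fin m → Option (Fin q)) + 4) * 10 + 27 * is.length) *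
        (n + 1) ^ (is.length + 1) * (N + 1)
    set rows : List (Fin n → Bool × Bool) := (List.finRange n).map (row D) with hrows
    have hrl : rows.length = n := by simp [hrows]
    -- The cells still hold the entry of the previous round, and nothing before the first round.
    let prev : ℕ → Option (Fin n) := fun j => if h : 0 < j ∧ j ≤ n then some ⟨j - 1, by omega⟩ else none
    let Wj : ℕ → List (Fin n → Option (Fin q)) := fun j => processTuples br D W
      (((List.finRange n).take j).flatMap fun j => tuples is (Function.update v i (some j)))
    let st : ℕ → Mem q m := fun j => { S with
      w := flat (Wj j)
      w2 := []
      mat := Function.update S.mat i (flat (rows.drop j))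
      mat2 := Function.update S.mat2 i (flat (rows.take j)).reverse }
    have h1 := does_while (k := .mat i) (c := fun _ o => o.isSome)
      (p := .seq (forCells (overlay i)) (nest br is)) n ((n + 1) * 11 + T)
      (fun j => (st j).cells default
        (block (vcell D (Function.update v i (prev j)) fun _ => none)) [])
      (fun j hj => by
        change (Function.update S.mat i (flat (rows.drop j)) i).head?.isSome = true
        rw [Function.update_self, List.isSome_head?, ← List.length_pos_iff, length_flat]
        have : 0 < (rows.drop j).length := by simp [hrl, hj]
        positivity)
      (by
        change (Function.update S.mat i (flat (rows.drop n)) i).head?.isSome = false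
        rw [Function.update_self, List.drop_of_length_le hrl.le]
        rfl)
      (fun j hj => by
        have hr : rows[j] = row D ⟨j, hj⟩ := by simp [hrows]
        have h1 := does_overlay D (Function.update v i (prev j)) (fun _ => none) i ⟨j, hj⟩ (st j)
          (by simp only [st]; rw [hS]; rfl) (flat (rows.drop (j + 1))) (by
            simp only [st, Function.update_self]
            rw [List.drop_eq_getElem_cons (by omega), ← hr]
            rfl)
        have h2 := ih his (Function.update v i (some ⟨j, hj⟩))
          (fun k hk => by
            have hne : k ≠ i := fun e => hi (e ▸ hk)
            rw [Function.update_of_ne hne]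
            exact hv k (List.mem_cons_of_mem _ hk)) (Wj j) (hgood _ _ hW) (st (j + 1)) hS
          (fun k hk => by
            have hne : k ≠ i := fun e => hi (e ▸ hk)
            simp only [st, Function.update_of_ne hne]
            exact hM k (List.mem_cons_of_mem _ hk))
        have hp : prev (j + 1) = some ⟨j, hj⟩ := by simp [prev, hj]
        rw [hp]
        refine Does.seq (h1.congr ?_) (h2.congr ?_)
        · simp only [st, Function.update_idem, Function.update_self, List.take_add_one,
            List.getElem?_eq_getElem (show j < rows.length by omega), Option.toList_some, flat_append,
            List.reverse_append, hr]
          simp [flat]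
        · have : processTuples br D (Wj j) (tuples is (Function.update v i (some ⟨j, hj⟩))) =
              Wj (j + 1) := by
            simp only [Wj, processTuples, List.take_add_one,
              List.getElem?_eq_getElem (show j < (List.finRange n).length by simpa using hj),
              Option.toList_some, List.flatMap_append, List.foldl_append, List.flatMap_singleton,
              List.getElem_finRange]
            rfl
          rw [this])
    obtain ⟨hMi, hMi2⟩ := hM i List.mem_cons_self
    have h2 := does_restore i ((st n).cells default
        (block (vcell D (Function.update v i (prev n)) fun _ => none)) [])
        (by simp only [st, Mem.cells]; rw [hS]; rfl) []
        (matrixWord D).reverse (by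
          simp only [st, Mem.cells, Function.update_self]
          rw [List.drop_of_length_le hrl.le]; rfl) (by
          simp only [st, Mem.cells, Function.update_self]
          rw [List.take_of_length_le hrl.le]; rfl)
    have h3 := does_clearLayer D (Function.update v i (prev n)) (fun _ => none) i
      { S with w := flat (processTuples br D W (tuples (i :: is) v)), w2 := [] }
    have hWn : Wj n = processTuples br D W (tuples (i :: is) v) := by
      simp only [Wj]
      rw [List.take_of_length_le (by simp)]
      rfl
    rw [Function.update_idem, (Function.update_eq_self_iff (a := i) (f := v)).2
      (hv i List.mem_cons_self).symm] at h3
    refine Does.mono (t := (n * ((n + 1) * 11 + T + 1) + 1) + ((4 * (matrixWord D).reverse.length + 1) +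
      (n + 1) * 9)) ?_ ?_
    · refine Does.seq (s' := (st n).cells default
        (block (vcell D (Function.update v i (prev n)) fun _ => none)) []) ?_
        (Does.seq (h2.congr ?_) h3)
      · refine Eq.mp (congrArg (fun s => Does (whileNE (.mat i)
          (.seq (forCells (overlay i)) (nest br is))) s _ _) ?_) h1
        have hp : prev 0 = v i := by rw [hv i List.mem_cons_self]; simp [prev]
        have hr0 : flat (rows.drop 0) = S.mat i := hMi.symm
        have hr1 : (flat (rows.take 0)).reverse = S.mat2 i := hMi2.symm
        simp only [st, hp, hr0, hr1, Function.update_eq_self]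
        rfl
      · simp only [st, Mem.cells, hWn, Function.update_idem, List.reverse_reverse, List.append_nil]
        rw [← hMi, ← hMi2, Function.update_eq_self, Function.update_eq_self]
    · rw [List.length_reverse, length_matrixWord]
      -- The term `27 * (n + 1) ^ 2` pays for the overlays, the restoration of the matrix copy and
      -- the clearing of the layer at this level.
      have e : ((Fintype.card (Fin m → Option (Fin q)) + 4) * 10 + 27 * (i :: is).length) *
        (n + 1) ^ ((i :: is).length + 1) * (N + 1) = (n + 1) * T +
          27 * ((n + 1) ^ 2 * ((n + 1) ^ is.length * (N + 1))) := by
        simp only [T, List.length_cons]; ring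
      rw [e]
      have e2 : 1 ≤ (n + 1) ^ is.length * (N + 1) := Nat.mul_pos (by positivity) (by omega)
      have e3 : (n + 1) ^ 2 ≤ (n + 1) ^ 2 * ((n + 1) ^ is.length * (N + 1)) :=
        Nat.le_mul_of_pos_right _ e2
      nlinarith

end Branching

/-! ### Reading the input, and the complete program. -/

namespace Branching

variable {q m n : ℕ}

/-- Read the number of vertices, in unary, and create as many cells. -/
def readUnary : Prg q m :=
  .seq (.while .inp (fun _ o => Option.getD o false) (.seq (.pop .inp fun r _ => r)
    (.seq (.push .v fun _ => (default : Cell q m)) (.push .cnt fun _ => ())))) (.pop .inp fun r _ => r)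

theorem block_const {α : Type} (x : α) : block (fun _ : Fin n => x) = List.replicate n x := by
  simp [block]

theorem does_readUnary (n : ℕ) (S : Mem q m) (l : List Bool) :
    Does readUnary { S with inp := List.replicate n true ++ false :: l, v := [], cnt := [] }
      { S with inp := l, v := block fun _ : Fin n => default, cnt := List.replicate n () }
      (n * 4 + 2) := by
  have h1 := does_while (k := .inp) (c := fun _ o => Option.getD o false)
    (p := .seq (.pop .inp fun r _ => r)
    (.seq (.push .v fun _ => (default : Cell q m)) (.push .cnt fun _ => ()))) n (1 + (1 + 1))
    (fun j => { S with
      inp := List.replicate (n - j) true ++ false :: l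
      v := List.replicate j default
      cnt := List.replicate j () })
    (fun j hj => by
      change (List.replicate (n - j) true ++ false :: l).head?.getD false = true
      rw [show n - j = (n - j - 1) + 1 by omega]; rfl)
    (by simp [Mem.stk])
    (fun j hj => by
      refine ((does_pop _ _ _).seq ((does_push _ _ _).seq (does_push _ _ _))).congr ?_
      simp only [Mem.stk, Mem.set]
      rw [show n - j = (n - (j + 1)) + 1 by omega]
      rfl)
  refine ((h1.seq (does_pop_inp _ _)).congr ?_).mono (by omega)
  simp [block_const]

/-- Put the bit of the register on all matrix stacks. -/
def pushAll (is : List (Fin m)) : Prg q m :=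
  StackProg.seqList (is.map fun i => .push (.mat2 i) fun r => r.bit)

theorem does_pushAll (is : List (Fin m)) (his : is.Nodup) (S : Mem q m) :
    Does (pushAll is) S { S with mat2 := fun i => if i ∈ is then S.reg.bit :: S.mat2 i else S.mat2 i }
      (is.length + 1) := by
  induction is generalizing S with
  | nil => exact ((does_skip S).congr (by simp)).mono (by simp)
  | cons i is ih =>
    obtain ⟨hi, his⟩ := List.nodup_cons.1 his
    refine (((does_push_mat2 i _ _).seq (ih his _)).congr ?_).mono ?_
    · congr 1
      funext k
      rcases eq_or_ne k i with rfl | h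
      · simp [hi]
      · simp [h]
    · simp only [List.length_cons]; omega

/-- Put all matrix copies in place. -/
def restoreAll (is : List (Fin m)) : Prg q m := StackProg.seqList (is.map restore)

theorem does_restoreAll (is : List (Fin m)) (his : is.Nodup) (S : Mem q m)
    (hb : S.reg.bit = default) (N : ℕ) (h : ∀ i ∈ is, (S.mat2 i).length ≤ N) :
    Does (restoreAll is) S { S with
        mat := fun i => if i ∈ is then (S.mat2 i).reverse ++ S.mat i else S.mat i
        mat2 := fun i => if i ∈ is then [] else S.mat2 i }
      (is.length * (4 * N + 1) + 1) := by
  induction is generalizing S with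
  | nil => exact ((does_skip S).congr (by simp)).mono (by simp)
  | cons i is ih =>
    obtain ⟨hi, his⟩ := List.nodup_cons.1 his
    refine (((does_restore i S hb _ _ rfl rfl).seq (ih his _ hb fun k hk => ?_)).congr ?_).mono ?_
    · have hne : k ≠ i := fun e => hi (e ▸ hk)
      simpa only [Function.update_of_ne hne] using h k (List.mem_cons_of_mem _ hk)
    · congr 1
      all_goals
        funext k
        rcases eq_or_ne k i with rfl | h
        · simp [hi]
        · simp [h]
    · have := h i List.mem_cons_self
      simp only [List.length_cons]
      rw [add_mul (is.length)]
      omega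

/-- Read one entry of the adjacency matrix. The flag and the `done` fields of the cells locate the
diagonal. -/
def readEntry : Prg q m :=
  .seq (.pop .inp fun r o => { r with
      bit := (Option.getD o false, !r.flag && !r.cell.done)
      flag := r.flag || (!r.flag && !r.cell.done)
      cell := { r.cell with done := r.cell.done || (!r.flag && !r.cell.done) } })
    (.seq (pushAll (List.finRange m)) (.load fun r => { r with bit := default }))

/-- A cell of which nothing is known except whether its row has been read. -/
def blankCell (d : Bool) : Cell q m := { (default : Cell q m) with done := d }

theorem does_readRow (D : Data q n) (j : Fin n) (S : Mem q m) (hS : S.reg = default) (l : List Bool)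
    (l2 : List (Bool × Bool)) :
    Does (.seq (forCells readEntry) (.load fun r => { r with flag := false }))
      ({ S with inp := block (D.A j) ++ l, mat2 := fun _ => l2 }.cells default
        (block fun u : Fin n => blankCell (decide (u.1 < j.1))) [])
      ({ S with inp := l, mat2 := fun _ => (block (row D j)).reverse ++ l2 }.cells default
        (block fun u : Fin n => blankCell (decide (u.1 < j.1 + 1))) []) ((n + 1) * (m + 12)) := by
  have := does_forCells (body := readEntry) (fun u : Fin n => blankCell (decide (u.1 < j.1)))
    (fun u : Fin n => blankCell (decide (u.1 < j.1 + 1)))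
    (fun k => { S with
      inp := (block (D.A j)).drop k ++ l
      reg := { S.reg with flag := decide (j.1 < k) }
      mat2 := fun _ => ((block (row D j)).take k).reverse ++ l2 }) (1 + ((m + 1) + 1))
    (fun u l1 l2 => by
      have h1 := fun S : Mem q m => does_pushAll (List.finRange m) (List.nodup_finRange m) S
      simp only [List.length_finRange] at h1
      refine ((does_pop_inp _ _).seq ((h1 _).seq (does_load _ _))).congr ?_
      simp only [Mem.cells]
      rw [drop_block, take_block]
      -- When `u` is reached in row `j`, the flag says `j < u` and the field `done` says `u < j`.
      -- The diagonal is where neither holds.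
      have e1 : (!decide (j < u) && !decide (u < j)) = decide (u = j) := by
        rcases lt_trichotomy u j with h | rfl | h
        · simp [h, h.ne]
        · simp
        · simp [h, h.ne']
      simp only [Fin.val_fin_lt, Order.lt_add_one_iff, Fin.val_fin_le, blankCell, hS, row]
      simp [e1, le_iff_lt_or_eq, eq_comm]
      rfl)
  refine Does.mono (t := (n + 1) * (1 + ((m + 1) + 1) + 8) + 1) ?_ (by ring_nf; nlinarith)
  refine Does.seq (s' := _) (Eq.mp (congrArg (fun s => Does _ s _ _) ?_) this)
    ((does_load _ _).congr ?_)
  · simp [hS]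
    rfl
  · rw [List.drop_of_length_le (by simp), List.take_of_length_le (by simp)]
    simp [hS, Mem.cells]
    rfl

/-- Read the adjacency matrix. -/
def readMatrix : Prg q m :=
  .seq (whileNE .cnt (.seq (.pop .cnt fun r _ => r)
    (.seq (forCells readEntry) (.load fun r => { r with flag := false }))))
    (restoreAll (List.finRange m))

/-- The unary counter left by `readUnary` supplies the number of rows. Reading leaves each copy
reversed on its `mat2` stack, and the restoration puts it in order. -/
theorem does_readMatrix (D : Data q n) (S : Mem q m) (hS : S.reg = default) (l : List Bool) :
    Does readMatrix
      ({ S with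
        inp := flat ((List.finRange n).map D.A) ++ l
        cnt := List.replicate n ()
        mat := fun _ => []
        mat2 := fun _ => [] }.cells default (block fun _ : Fin n => blankCell false) [])
      ({ S with
        inp := l
        cnt := []
        mat := fun _ => matrixWord D
        mat2 := fun _ => [] }.cells default (block fun _ : Fin n => blankCell true) [])
      ((n + 1) ^ 2 * (5 * m + 16)) := by
  have hl : (List.finRange n).length = n := by simp
  have h1 := does_while (k := .cnt) (c := fun _ o => o.isSome)
    (p := .seq (.pop .cnt fun r _ => r)
      (.seq (forCells readEntry) (.load fun r => { r with flag := false }))) n (1 + (n + 1) * (m + 12))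
    (fun j => { S with
      inp := flat (((List.finRange n).drop j).map D.A) ++ l
      cnt := List.replicate (n - j) ()
      mat := fun _ => []
      mat2 := fun _ => (flat (((List.finRange n).take j).map (row D))).reverse }.cells default
        (block fun u : Fin n => blankCell (decide (u.1 < j))) [])
    (fun j hj => by
      change (List.replicate (n - j) ()).head?.isSome = true
      rw [show n - j = (n - j - 1) + 1 by omega]; rfl)
    (by simp [Mem.stk, Mem.cells])
    (fun j hj => by
      have h2 := does_readRow (m := m) D ⟨j, hj⟩ { S with
        cnt := List.replicate (n - (j + 1)) ()
        mat := fun _ => [] } hS (flat (((List.finRange n).drop (j + 1)).map D.A) ++ l)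
        (flat (((List.finRange n).take j).map (row D))).reverse
      refine Does.seq ((does_pop .cnt _ _).congr ?_) (h2.congr ?_)
      · simp only [Mem.stk, Mem.set, Mem.cells]
        rw [show n - j = (n - (j + 1)) + 1 by omega,
          List.drop_eq_getElem_cons (by omega : j < (List.finRange n).length)]
        simp [flat, List.replicate_succ]
      · rw [List.take_add_one, List.getElem?_eq_getElem (by omega : j < (List.finRange n).length)]
        simp only [Option.toList_some, List.map_append, flat_append, List.reverse_append,
          List.getElem_finRange]
        simp [flat])
  have h2 := does_restoreAll (List.finRange m) (List.nodup_finRange m) ({ S with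
      inp := l
      cnt := []
      mat := fun _ => []
      mat2 := fun _ => (matrixWord D).reverse }.cells default
        (block fun _ : Fin n => blankCell true) []) (by simp [Mem.cells, hS]; rfl) (n * n)
        (fun i _ => by
          change (matrixWord D).reverse.length ≤ _
          rw [List.length_reverse, length_matrixWord])
  refine Does.mono (t := n * ((1 + (n + 1) * (m + 12)) + 1) + 1 + (m * (4 * (n * n) + 1) + 1)) ?_ ?_
  · rw [List.length_finRange] at h2
    refine Does.seq (s' := _) (Eq.mp (congrArg₂ (fun s s' => Does _ s s' _) ?_ ?_) h1) (h2.congr ?_)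
    · simp
      rfl
    · rw [List.drop_of_length_le hl.le, List.take_of_length_le hl.le]
      simp [flat, matrixWord]
    · simp [Mem.cells]
  · nlinarith [Nat.zero_le (n * m), Nat.zero_le (n * n * m)]

/-- Read the characteristic vector of the modulator. -/
def readX : Prg q m :=
  .pop .inp fun r o => { r with cell := { r.cell with inX := Option.getD o false } }

theorem does_readX (x : Fin n → Bool) (f : Fin n → Cell q m) (S : Mem q m) (l : List Bool) :
    Does (forCells readX) ({ S with inp := block x ++ l }.cells default (block f) [])
      ({ S with inp := l }.cells default (block fun u => { f u with inX := x u }) [])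
      ((n + 1) * 9) := by
  have := does_forCells (body := readX) f (fun u => { f u with inX := x u })
    (fun k => { S with inp := (block x).drop k ++ l }) 1
    (fun u l1 l2 => by
      refine (does_pop_inp _ _).congr ?_
      simp only [Mem.cells]
      rw [drop_block]
      rfl)
  refine this.congr ?_
  rw [List.drop_of_length_le (by simp)]
  rfl

/-- Read whether the colors `cs` are allowed for the current vertex. -/
def readColors (cs : List (Fin q)) : Prg q m :=
  StackProg.seqList (cs.map fun c => .pop .inp fun r o =>
    { r with cell := { r.cell with lst := Function.update r.cell.lst c (Option.getD o false) } })

theorem does_readColors (g : Fin q → Bool) (cs : List (Fin q)) (S : Mem q m) (l : List Bool) :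
    Does (readColors cs) { S with inp := cs.map g ++ l }
      { S with
        inp := l
        reg := { S.reg with
          cell := { S.reg.cell with lst := fun c => if c ∈ cs then g c else S.reg.cell.lst c } } }
      (cs.length + 1) := by
  induction cs generalizing S with
  | nil => exact ((does_skip _).congr (by simp)).mono (by simp)
  | cons c cs ih =>
    refine ((does_pop_inp _ _).seq (Eq.mp (congrArg (fun s => Does _ s _ _) ?_)
      (ih { S with reg := { S.reg with cell := { S.reg.cell with
        lst := Function.update S.reg.cell.lst c (g c) } } }))).congr ?_ |>.mono ?_
    · simp
    · have : (fun k => if k ∈ cs then g k else Function.update S.reg.cell.lst c (g c) k) =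
          fun k => if k ∈ c :: cs then g k else S.reg.cell.lst k := by
        funext k
        rcases eq_or_ne k c with rfl | h
        · simp
        · simp [h]
      simp only [this]
    · simp only [List.length_cons]; omega

/-- Read the lists of colors, if there are any, and otherwise allow all colors. -/
def readLists (b : Bool) : Prg q m :=
  if b then forCells (readColors (List.finRange q))
  else forCells (.load fun r => { r with cell := { r.cell with lst := fun _ => true } })

theorem does_readLists (b : Bool) (g : Fin n → Fin q → Bool) (hg : b = false → g = fun _ _ => true)
    (f : Fin n → Cell q m) (S : Mem q m) (l : List Bool) (hl : b = false → l = []) (hl' : b = true →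
      l = (List.finRange n).flatMap fun v => (List.finRange q).map (g v)) :
    Does (readLists b) ({ S with inp := l }.cells default (block f) [])
      ({ S with inp := [] }.cells default (block fun u => { f u with lst := g u }) [])
      ((n + 1) * (q + 9)) := by
  cases b with
  | false =>
    obtain rfl := hg rfl
    obtain rfl := hl rfl
    exact (does_forCells f (fun u => { f u with lst := fun _ => true }) (fun _ => { S with inp := [] })
      1 fun _ _ _ => does_load _ _).mono (Nat.mul_le_mul_left _ (by omega))
  | true =>
    obtain rfl := hl' rfl
    have := does_forCells (body := readColors (List.finRange q)) f (fun u => { f u with lst := g u })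
      (fun k => { S with
        inp := ((List.finRange n).drop k).flatMap fun v => (List.finRange q).map (g v) }) (q + 1)
      (fun u l1 l2 => by
        have h1 := does_readColors (m := m) (g u) (List.finRange q) ({ S with inp := [] }.cells (f u) l1 l2)
          (((List.finRange n).drop (u + 1)).flatMap fun v => (List.finRange q).map (g v))
        rw [List.length_finRange] at h1
        convert h1 using 1
        · rw [List.drop_eq_getElem_cons (by simp : (u : ℕ) < (List.finRange n).length)]
          simp [Mem.cells]
        · simp [Mem.cells])
    refine (this.congr ?_).mono (le_of_eq (by ring))
    rw [List.drop_of_length_le (by simp)]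
    rfl

/-- Create the assignment that assigns nothing. -/
def initAsg : Prg q m := .push .w fun _ => none

theorem does_initAsg (f : Fin n → Cell q m) (S : Mem q m) :
    Does (forCells initAsg) ({ S with w := [] }.cells default (block f) [])
      ({ S with w := flat [fun _ : Fin n => none] }.cells default (block f) []) ((n + 1) * 9) := by
  have := does_forCells (body := initAsg) f f (fun k => { S with w := List.replicate k none }) 1
    (fun u l1 l2 => does_push_w _ _)
  refine this.congr ?_
  simp [flat, block_const]

/-- The program: read the instance, then process all tuples, and accept if an assignment is left. -/
noncomputable def mainProg (b : Bool) (br : (Fin m → Cell q m) → (Fin m → Option (Fin q)) → Bool) :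
    Prg q m :=
  .seq readUnary (.seq readMatrix (.seq (forCells readX) (.seq (readLists b) (.seq (forCells initAsg)
    (.ite .v (fun _ o => o.isNone) (.load fun r => { r with flag := true })
      (.seq (nest br (List.finRange m))
        (.ite .w (fun _ o => o.isSome) (.load fun r => { r with flag := true }) skip)))))))

theorem does_mainProg (b : Bool) (br : (Fin m → Cell q m) → (Fin m → Option (Fin q)) → Bool)
    (D : Data q n) (hg : b = false → D.lst = fun _ _ => true)
    (N : ℕ) (Good : List (Fin n → Option (Fin q)) → Prop)
    (hstep : ∀ W (v : Fin m → Option (Fin n)), Good W → Good (W.flatMap (step br D v)))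
    (hlen : ∀ W, Good W → W.length ≤ N) (h0 : Good [fun _ => none]) :
    ∃ S' : Mem q m, Does (mainProg b br)
      ⟨default, List.replicate n true ++ [false] ++ flat ((List.finRange n).map D.A) ++ block D.X ++
        (if b then (List.finRange n).flatMap fun v => (List.finRange q).map (D.lst v) else []),
        [], [], [], [], [], fun _ => [], fun _ => []⟩ S'
      (((Fintype.card (Fin m → Option (Fin q)) + 4) * 10 + 32 * m + q + 100) *
        (n + 1) ^ (m + 2) * (N + 1)) ∧
      (S'.reg.flag = true ↔ n = 0 ∨ processTuples br D [fun _ => none]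
        (tuples (List.finRange m) fun _ => none) ≠ []) := by
  set L := (if b then (List.finRange n).flatMap fun v => (List.finRange q).map (D.lst v) else [])
  set S0 : Mem q m := ⟨default, [], [], [], [], [], [], fun _ => [], fun _ => []⟩
  set S1 : Mem q m := { S0 with mat := fun _ => matrixWord D }
  have h1 := does_readUnary n S0 (flat ((List.finRange n).map D.A) ++ (block D.X ++ L))
  have h2 := does_readMatrix D S0 rfl (block D.X ++ L)
  have h3 := does_readX D.X (fun _ => blankCell true) S1 L
  have h4 := does_readLists b D.lst hg (fun u => { blankCell true with inX := D.X u }) S1 L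
    (fun h => by simp [L, h]) (fun h => by simp [L, h])
  have h5 := does_initAsg (vcell D (fun _ : Fin m => none) fun _ => none) S1
  set tail : Prg q m := .ite .v (fun _ o => o.isNone) (.load fun r => { r with flag := true })
      (.seq (nest br (List.finRange m))
        (.ite .w (fun _ o => o.isSome) (.load fun r => { r with flag := true }) skip))
  have key : ∃ S', Does tail ({ S1 with w := flat [fun _ : Fin n => none] }.cells default
      (block (vcell D (fun _ : Fin m => none) fun _ => none)) []) S'
      (((Fintype.card (Fin m → Option (Fin q)) + 4) * 10 + 27 * m) * (n + 1) ^ (m + 1) * (N + 1) + 3) ∧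
      (S'.reg.flag = true ↔ n = 0 ∨ processTuples br D [fun _ => none]
        (tuples (List.finRange m) fun _ => none) ≠ []) := by
    -- Without vertices an assignment is the empty word, and the stack `w` cannot tell whether one
    -- is left. The program therefore accepts this case directly.
    rcases Nat.eq_zero_or_pos n with rfl | hn
    · exact ⟨_, (Does.ite_true rfl (does_load _ _)).mono (by omega), by simp⟩
    · have h6 := does_nest hn br D N Good hstep hlen (List.finRange m) (List.nodup_finRange m)
        (fun _ => none) (fun _ _ => rfl) _ h0 S1 rfl (fun _ _ => ⟨rfl, rfl⟩)
      rw [List.length_finRange] at h6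
      have hv : (block (vcell D (fun _ : Fin m => none) fun _ => none)).head?.isNone = false := by
        have := drop_block (vcell D (fun _ : Fin m => none) fun _ => none) ⟨0, hn⟩
        rw [List.drop_zero] at this
        rw [this]
        rfl
      set W' := processTuples br D [fun _ => none] (tuples (List.finRange m) fun _ => none)
      have hw : (flat W').head?.isSome = true ↔ W' ≠ [] := by
        rw [List.isSome_head?, ← List.length_pos_iff, length_flat, ← List.length_pos_iff]
        exact ⟨fun h => Nat.pos_of_mul_pos_right h, fun h => Nat.mul_pos h hn⟩
      set s2 : Mem q m := { S1 with w := flat W', w2 := [] }.cells default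
            (block (vcell D (fun _ : Fin m => none) fun _ => none)) []
      change (s2.stk .w).head?.isSome = true ↔ W' ≠ [] at hw
      by_cases hW : W' = []
      · have h7 := Does.ite_false (k := .w) (c := fun _ o => o.isSome)
          (p := .load fun r => { r with flag := true })
          (s := s2)
          (eq_false_of_ne_true fun h => hw.1 h hW) (does_skip _)
        refine ⟨_, (Does.ite_false hv (h6.seq h7)).mono (by omega), ?_⟩
        simp only [hW, hn.ne']
        simp [s2, S1, S0, Mem.cells]
      · have h7 := Does.ite_true (k := .w) (c := fun _ o => o.isSome) (p' := skip)
          (s := s2)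
          (hw.2 hW) (does_load (fun r => { r with flag := true }) _)
        refine ⟨_, (Does.ite_false hv (h6.seq h7)).mono (by omega), ?_⟩
        simp [hW]
  obtain ⟨S', h6, h7⟩ := key
  refine ⟨S', ?_, h7⟩
  refine Does.mono ((Eq.mp (congrArg (fun s => Does _ s _ _) ?_) h1).seq
    (h2.seq (h3.seq (h4.seq (h5.seq h6))))) ?_
  · simp [S0]
  · have e1 : (n + 1) * 9 + ((n + 1) * (q + 9) + ((n + 1) * 9)) + (n + 1) ^ 2 * (5 * m + 16) + (n * 4 + 2) + 3 ≤
      (n + 1) ^ 2 * (5 * m + q + 100) := by nlinarith [Nat.zero_le (n * q), Nat.zero_le (n * n * q)]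
    have e2 : (n + 1) ^ 2 * (5 * m + q + 100) ≤ (5 * m + q + 100) * (n + 1) ^ (m + 2) * (N + 1) := by
      rw [mul_comm]
      refine le_trans ?_ (Nat.le_mul_of_pos_right _ (Nat.succ_pos N))
      gcongr <;> omega
    have e3 : ((Fintype.card (Fin m → Option (Fin q)) + 4) * 10 + 27 * m) * (n + 1) ^ (m + 1) * (N + 1) ≤
        ((Fintype.card (Fin m → Option (Fin q)) + 4) * 10 + 27 * m) * (n + 1) ^ (m + 2) * (N + 1) := by
      gcongr <;> omega
    have e4 : ((Fintype.card (Fin m → Option (Fin q)) + 4) * 10 + 32 * m + q + 100) * (n + 1) ^ (m + 2) * (N + 1) =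
      ((Fintype.card (Fin m → Option (Fin q)) + 4) * 10 + 27 * m) * (n + 1) ^ (m + 2) * (N + 1) +
        (5 * m + q + 100) * (n + 1) ^ (m + 2) * (N + 1) := by ring
    omega

end Branching

/-! ### The branching rule: correctness and the potential. -/

namespace Branching

variable {q m n : ℕ}

/-- A coloring of a tuple is compatible with the equalities in the tuple and with the assignment. -/
def Respects (τ : Fin m → Cell q m) (γ : Fin m → Fin q) : Prop :=
  (∀ i j, (τ i).mark j = true → γ i = γ j) ∧
    ∀ i c, (τ i).inX = true → (τ i).asg = some c → γ i = c

/-- A coloring of a tuple obeys the lists and is proper. -/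
def Fits (τ : Fin m → Cell q m) (γ : Fin m → Fin q) : Prop :=
  (∀ i, (τ i).lst (γ i) = true) ∧ ∀ i j, (τ i).adj j = true → γ i ≠ γ j

/-- The restriction of a coloring of a tuple to the modulator. -/
def proj (τ : Fin m → Cell q m) (γ : Fin m → Fin q) (i : Fin m) : Option (Fin q) :=
  if (τ i).inX then some (γ i) else none

/-- The colorings of the modulator vertices in a tuple. -/
def possible (τ : Fin m → Cell q m) : Set (Fin m → Option (Fin q)) :=
  {δ | ∃ γ, Respects τ γ ∧ δ = proj τ γ}

/-- The colorings of the modulator vertices in a tuple that extend to the tuple. -/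
def feasible (τ : Fin m → Cell q m) : Set (Fin m → Option (Fin q)) :=
  {δ | ∃ γ, Respects τ γ ∧ Fits τ γ ∧ δ = proj τ γ}

open Classical in
/-- The branching rule: when some coloring of the modulator vertices in the tuple does not extend to
the tuple, branch over those that do. -/
noncomputable def branch (τ : Fin m → Cell q m) (δ : Fin m → Option (Fin q)) : Bool :=
  if (∀ i, (τ i).mark i = true) ∧ feasible τ ≠ possible τ then decide (δ ∈ feasible τ)
  else decide (δ = fun _ => none)

/-- The coloring `g` extends the partial assignment `a` of the modulator. -/
def Ext (D : Data q n) (a : Fin n → Option (Fin q)) (g : Fin n → Fin q) : Prop :=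
  ∀ w c, D.X w = true → a w = some c → g w = c

/-- The coloring `g` obeys the lists and is proper on the tuple `u`. -/
def FitsOn (D : Data q n) (g : Fin n → Fin q) (u : Fin m → Fin n) : Prop :=
  (∀ i, D.lst (u i) (g (u i)) = true) ∧ ∀ i j, D.A (u j) (u i) = true → g (u i) ≠ g (u j)

open Classical in
/-- Assign the modulator vertices of the tuple `u` according to `g`. -/
noncomputable def assign (D : Data q n) (g : Fin n → Fin q) (u : Fin m → Fin n)
    (a : Fin n → Option (Fin q)) (w : Fin n) : Option (Fin q) :=
  if D.X w = true ∧ w ∈ Set.range u then some (g w) else a w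

/-- The tuple with entries `u`. -/
def total (u : Fin m → Fin n) (i : Fin m) : Option (Fin n) := some (u i)

theorem respects_comp {D : Data q n} {a : Fin n → Option (Fin q)} {g : Fin n → Fin q}
    (h : Ext D a g) (u : Fin m → Fin n) : Respects (tau D (total u) a) (g ∘ u) :=
  ⟨fun _ _ hij => congrArg g (of_decide_eq_true hij), fun i c hX hc => h (u i) c hX hc⟩

/-- Positions that hold the same vertex have the same color, so the coloring of positions descends
to vertices. Vertices outside the tuple take their assigned color, or `0`. -/
theorem exists_comp_of_respects [NeZero q] {D : Data q n} {a : Fin n → Option (Fin q)}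
    {u : Fin m → Fin n} {γ : Fin m → Fin q} (h : Respects (tau D (total u) a) γ) :
    ∃ g, Ext D a g ∧ γ = g ∘ u := by
  classical
  have h1 : ∀ i j, u i = u j → γ i = γ j := fun i j hij => h.1 i j (decide_eq_true hij)
  have h2 : ∀ i c, D.X (u i) = true → a (u i) = some c → γ i = c := h.2
  refine ⟨fun w => if hw : ∃ i, u i = w then γ hw.choose else (a w).getD 0, fun w c hX hc => ?_, ?_⟩
  · by_cases hw : ∃ i, u i = w
    · simp only [dif_pos hw]
      exact h2 _ c (by rw [hw.choose_spec]; exact hX) (by rw [hw.choose_spec]; exact hc)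
    · simp [hw, hc]
  · funext i
    have hw : ∃ j, u j = u i := ⟨i, rfl⟩
    simp only [Function.comp, dif_pos hw]
    exact h1 _ _ hw.choose_spec.symm

/-- This and `mem_feasible` translate the rule, which only sees the cells in the register, into
colorings of the whole vertex set. -/
theorem mem_possible [NeZero q] {D : Data q n} {a : Fin n → Option (Fin q)} {u : Fin m → Fin n} {δ} :
    δ ∈ possible (tau D (total u) a) ↔ ∃ g, Ext D a g ∧ δ = proj (tau D (total u) a) (g ∘ u) := by
  constructor
  · rintro ⟨γ, h, rfl⟩
    obtain ⟨g, hg, rfl⟩ := exists_comp_of_respects h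
    exact ⟨g, hg, rfl⟩
  · rintro ⟨g, hg, rfl⟩
    exact ⟨_, respects_comp hg u, rfl⟩

theorem mem_feasible [NeZero q] {D : Data q n} {a : Fin n → Option (Fin q)} {u : Fin m → Fin n} {δ} :
    δ ∈ feasible (tau D (total u) a) ↔
      ∃ g, Ext D a g ∧ FitsOn D g u ∧ δ = proj (tau D (total u) a) (g ∘ u) := by
  constructor
  · rintro ⟨γ, h, hf, rfl⟩
    obtain ⟨g, hg, rfl⟩ := exists_comp_of_respects h
    exact ⟨g, hg, hf, rfl⟩
  · rintro ⟨g, hg, hf, rfl⟩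
    exact ⟨_, respects_comp hg u, hf, rfl⟩

theorem feasible_subset (τ : Fin m → Cell q m) : feasible τ ⊆ possible τ := by
  rintro _ ⟨γ, h, -, rfl⟩
  exact ⟨γ, h, rfl⟩

theorem proj_eq_iff {D : Data q n} {a : Fin n → Option (Fin q)} {u : Fin m → Fin n}
    {g g' : Fin n → Fin q} :
    proj (tau D (total u) a) (g ∘ u) = proj (tau D (total u) a) (g' ∘ u) ↔
      ∀ i, D.X (u i) = true → g (u i) = g' (u i) := by
  rw [funext_iff]
  refine forall_congr' fun i => ?_
  change (if D.X (u i) = true then some (g (u i)) else none) =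
    (if D.X (u i) = true then some (g' (u i)) else none) ↔ _
  split <;> simp_all

theorem childAsg_proj (D : Data q n) (a a' : Fin n → Option (Fin q)) (u : Fin m → Fin n)
    (g : Fin n → Fin q) (w : Fin n) :
    childAsg (proj (tau D (total u) a') (g ∘ u)) (vcell D (total u) a w) = assign D g u a w := by
  -- The claim is generalized to arbitrary lists of positions for the induction. A vertex may occur
  -- several times in the tuple, but all its positions carry the same color.
  have key : ∀ l : List (Fin m), (l.findSome? fun i =>
      if (vcell D (total u) a w).mark i then proj (tau D (total u) a') (g ∘ u) i else none) =
      if D.X w = true ∧ ∃ i ∈ l, u i = w then some (g w) else none := by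
    intro l
    induction l with
    | nil => simp
    | cons i l ih =>
      rw [List.findSome?_cons]
      have e1 : (vcell D (total u) a w).mark i = decide (w = u i) := rfl
      have e2 : proj (tau D (total u) a') (g ∘ u) i = if D.X (u i) then some (g (u i)) else none := rfl
      rw [ih, e1, e2]
      by_cases hw : w = u i
      · subst hw
        by_cases hX : D.X (u i) = true <;> simp [hX]
      · simp [hw, Ne.symm hw]
  rw [childAsg, key, assign]
  simp only [List.mem_finRange, true_and, Set.mem_range]
  split <;> simp [vcell]

theorem childAsg_none (c : Cell q m) : childAsg (fun _ => none) c = c.asg := by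
  have : ((List.finRange m).findSome? fun i => if c.mark i then (none : Option (Fin q)) else none) = none :=
    List.findSome?_eq_none_iff.2 fun i _ => ite_self _
  rw [childAsg, this, Option.none_or]

/-- No branching is needed at the tuple `u`. -/
def Settled (D : Data q n) (u : Fin m → Fin n) (a : Fin n → Option (Fin q)) : Prop :=
  ∀ g, Ext D a g → ∃ g', (∀ i, D.X (u i) = true → g' (u i) = g (u i)) ∧ FitsOn D g' u

/-- The only selected `δ` assigns nothing, so the only child is `a` itself. -/
theorem step_of_not (D : Data q n) (v : Fin m → Option (Fin n)) (a : Fin n → Option (Fin q))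
    (h : ¬ ((∀ i, (tau D v a i).mark i = true) ∧ feasible (tau D v a) ≠ possible (tau D v a))) :
    step branch D v a = [a] := by
  classical
  have : (Finset.univ : Finset (Fin m → Option (Fin q))).toList.filter (branch (tau D v a)) =
      [fun _ => none] := by
    have e : branch (tau D v a) = fun δ => δ == fun _ => none := by
      funext δ
      rw [branch, if_neg h]
      rfl
    rw [e, List.filter_beq, List.count_eq_one_of_mem (Finset.nodup_toList _) (by simp)]
    rfl
  rw [step, this]
  simp only [List.map_cons, List.map_nil, childAsg_none]
  rfl

theorem settled_of_eq [NeZero q] {D : Data q n} {u : Fin m → Fin n} {a : Fin n → Option (Fin q)}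
    (h : feasible (tau D (total u) a) = possible (tau D (total u) a)) : Settled D u a := by
  intro g hg
  obtain ⟨g', -, hf, e⟩ := mem_feasible.1 (h ▸ mem_possible.2 ⟨g, hg, rfl⟩)
  exact ⟨g', fun i hi => (proj_eq_iff.1 e i hi).symm, hf⟩

/-- A missing entry is represented by the default cell, which carries no marks. -/
theorem total_of_mark {D : Data q n} {v : Fin m → Option (Fin n)} {a : Fin n → Option (Fin q)}
    (h : ∀ i, (tau D v a i).mark i = true) : ∃ u, v = total u := by
  have : ∀ i, ∃ w, v i = some w := fun i => by
    have hi := h i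
    rw [tau] at hi
    cases hv : v i with
    | none => rw [hv] at hi; exact Bool.noConfusion hi
    | some w => exact ⟨w, rfl⟩
  choose u hu using this
  exact ⟨u, funext hu⟩

theorem mark_total (D : Data q n) (u : Fin m → Fin n) (a : Fin n → Option (Fin q)) (i : Fin m) :
    (tau D (total u) a i).mark i = true := decide_eq_true rfl

open Classical in
theorem step_of_ne (D : Data q n) (u : Fin m → Fin n) (a : Fin n → Option (Fin q))
    (h : feasible (tau D (total u) a) ≠ possible (tau D (total u) a)) :
    step branch D (total u) a =
      ((Finset.univ.toList).filter fun δ => decide (δ ∈ feasible (tau D (total u) a))).map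
        fun δ w => childAsg δ (vcell D (total u) a w) := by
  have e : branch (tau D (total u) a) = fun δ => decide (δ ∈ feasible (tau D (total u) a)) := by
    funext δ
    rw [branch, if_pos ⟨mark_total D u a, h⟩]
  rw [step, e]

theorem mem_step_of_ne [NeZero q] {D : Data q n} {u : Fin m → Fin n} {a a' : Fin n → Option (Fin q)}
    (h : feasible (tau D (total u) a) ≠ possible (tau D (total u) a)) :
    a' ∈ step branch D (total u) a ↔ ∃ g, Ext D a g ∧ FitsOn D g u ∧ a' = assign D g u a := by
  rw [step_of_ne D u a h]
  simp only [List.mem_map, List.mem_filter, Finset.mem_toList, Finset.mem_univ, true_and,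
    decide_eq_true_eq, mem_feasible]
  constructor
  · rintro ⟨_, ⟨g, hg, hf, rfl⟩, rfl⟩
    exact ⟨g, hg, hf, funext fun w => childAsg_proj D a a u g w⟩
  · rintro ⟨g, hg, hf, rfl⟩
    exact ⟨_, ⟨g, hg, hf, rfl⟩, funext fun w => childAsg_proj D a a u g w⟩

theorem ext_of_ext_assign {D : Data q n} {u : Fin m → Fin n} {a : Fin n → Option (Fin q)}
    {g g' : Fin n → Fin q} (hg : Ext D a g) (h : Ext D (assign D g u a) g') : Ext D a g' := by
  intro w c hX hc
  by_cases hw : w ∈ Set.range u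
  · rw [h w (g w) hX (if_pos ⟨hX, hw⟩)]
    exact hg w c hX hc
  · exact h w c hX (by rw [assign, if_neg fun h => hw h.2]; exact hc)

/-- The assignments in a step refine the one that they replace. -/
theorem ext_of_mem_step [NeZero q] {D : Data q n} {u : Fin m → Fin n}
    {a a' : Fin n → Option (Fin q)} (h : a' ∈ step branch D (total u) a) {g : Fin n → Fin q}
    (hg : Ext D a' g) : Ext D a g := by
  by_cases hne : feasible (tau D (total u) a) = possible (tau D (total u) a)
  · rw [step_of_not D _ a fun h => h.2 hne, List.mem_singleton] at h
    exact h ▸ hg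
  · obtain ⟨g', hg', -, rfl⟩ := (mem_step_of_ne hne).1 h
    exact ext_of_ext_assign hg' hg

/-- If there was no branching, every possible coloring is feasible. If there was, the child fixes
all modulator vertices of the tuple as in some coloring that fits on the tuple, and this coloring is
the witness. -/
theorem settled_of_mem_step [NeZero q] {D : Data q n} {u : Fin m → Fin n}
    {a a' : Fin n → Option (Fin q)} (h : a' ∈ step branch D (total u) a) : Settled D u a' := by
  by_cases hne : feasible (tau D (total u) a) = possible (tau D (total u) a)
  · rw [step_of_not D _ a fun h => h.2 hne, List.mem_singleton] at h
    exact h ▸ settled_of_eq hne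
  · obtain ⟨g', hg', hf, rfl⟩ := (mem_step_of_ne hne).1 h
    exact fun g hg => ⟨g', fun i hi => (hg (u i) _ hi (if_pos ⟨hi, i, rfl⟩)).symm, hf⟩

/-- No solution is lost: a coloring that fits on the tuple induces one of the branches. -/
theorem exists_mem_step_ext [NeZero q] {D : Data q n} {u : Fin m → Fin n}
    {a : Fin n → Option (Fin q)} {g : Fin n → Fin q} (hg : Ext D a g) (hf : FitsOn D g u) :
    ∃ a' ∈ step branch D (total u) a, Ext D a' g := by
  by_cases hne : feasible (tau D (total u) a) = possible (tau D (total u) a)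
  · rw [step_of_not D _ a fun h => h.2 hne]
    exact ⟨a, List.mem_singleton_self a, hg⟩
  · refine ⟨_, (mem_step_of_ne hne).2 ⟨g, hg, hf, rfl⟩, fun w c hX hc => ?_⟩
    rw [assign] at hc
    split at hc
    · exact Option.some.inj hc
    · exact hg w c hX hc

/-- The modulator vertices that are not assigned. -/
def free (D : Data q n) (a : Fin n → Option (Fin q)) : Finset (Fin n) :=
  Finset.univ.filter fun w => D.X w = true ∧ a w = none

open Classical in
theorem free_assign (D : Data q n) (g : Fin n → Fin q) (u : Fin m → Fin n)
    (a : Fin n → Option (Fin q)) :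
    free D (assign D g u a) = free D a \ Finset.univ.image u := by
  ext w
  by_cases hw : ∃ i, u i = w <;> by_cases hX : D.X w = true <;> simp [free, assign, hX, hw]

open Classical in
-- The assigned vertices leave no choice, so the colors of the free modulator vertices in the tuple
-- determine everything.
theorem ncard_possible_le [NeZero q] (D : Data q n) (u : Fin m → Fin n)
    (a : Fin n → Option (Fin q)) :
    (possible (tau D (total u) a)).ncard ≤ q ^ (free D a ∩ Finset.univ.image u).card := by
  set S := free D a ∩ Finset.univ.image u
  have h1 : possible (tau D (total u) a) ⊆ (fun f : S → Fin q =>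
      proj (tau D (total u) a) ((fun w => if h : w ∈ S then f ⟨w, h⟩ else (a w).getD 0) ∘ u)) ''
        Set.univ := by
    intro δ hδ
    obtain ⟨g, hg, rfl⟩ := mem_possible.1 hδ
    refine ⟨fun w => g w, trivial, proj_eq_iff.2 fun i hi => ?_⟩
    dsimp only
    split
    · rfl
    · rename_i h
      cases hc : a (u i) with
      | none => exact absurd (by simp [S, free, hi, hc]) h
      | some c => exact (hg _ c hi hc).symm
  calc (possible (tau D (total u) a)).ncard ≤ _ := Set.ncard_le_ncard h1 (Set.toFinite _)
    _ ≤ (Set.univ : Set (S → Fin q)).ncard := Set.ncard_image_le (Set.toFinite _)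
    _ = _ := by rw [Set.ncard_univ]; simp

open Classical in
theorem length_step_of_ne (D : Data q n) (u : Fin m → Fin n) (a : Fin n → Option (Fin q))
    (h : feasible (tau D (total u) a) ≠ possible (tau D (total u) a)) :
    (step branch D (total u) a).length = (feasible (tau D (total u) a)).ncard := by
  rw [step_of_ne D u a h, List.length_map, Set.ncard_eq_toFinset_card' ]
  rw [← List.toFinset_card_of_nodup ((Finset.nodup_toList _).filter _)]
  congr 1
  ext δ
  simp

/-- The potential of a list of assignments. -/
noncomputable def potential (b : ℝ) (D : Data q n) (W : List (Fin n → Option (Fin q))) : ℝ :=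
  (W.map fun a => b ^ (free D a).card).sum

/-- The heart of the running time. Branching happens only if some possible coloring is infeasible,
so there are at most `q ^ s - 1 ≤ b ^ s` children, and each has `s` fewer free vertices. For `s = 0`
there are no children at all. -/
theorem potential_step_le [NeZero q] {b : ℝ} (hb : 1 ≤ b) (hq : ∀ s ≤ m, (q : ℝ) ^ s - 1 ≤ b ^ s)
    (D : Data q n) (v : Fin m → Option (Fin n)) (a : Fin n → Option (Fin q)) :
    potential b D (step branch D v a) ≤ b ^ (free D a).card := by
  classical
  by_cases h : (∀ i, (tau D v a i).mark i = true) ∧ feasible (tau D v a) ≠ possible (tau D v a)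
  · obtain ⟨u, rfl⟩ := total_of_mark h.1
    set S := free D a ∩ Finset.univ.image u
    have h1 : ∀ a' ∈ step branch D (total u) a,
        b ^ (free D a').card = b ^ ((free D a).card - S.card) := by
      intro a' ha'
      obtain ⟨g, -, -, rfl⟩ := (mem_step_of_ne h.2).1 ha'
      rw [free_assign, Finset.card_sdiff, Finset.inter_comm]
    have hS : S.card ≤ (free D a).card := Finset.card_le_card Finset.inter_subset_left
    have hm : S.card ≤ m := (Finset.card_le_card Finset.inter_subset_right).trans
      (Finset.card_image_le.trans (by simp))
    have h2 : (step branch D (total u) a).length < q ^ S.card := by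
      rw [length_step_of_ne D u a h.2]
      exact (Set.ncard_lt_ncard ((feasible_subset _).ssubset_of_ne h.2) (Set.toFinite _)).trans_le
        (ncard_possible_le D u a)
    have h3 : ((step branch D (total u) a).length : ℝ) ≤ b ^ S.card := by
      refine le_trans ?_ (hq _ hm)
      rw [le_sub_iff_add_le]
      exact_mod_cast h2
    rw [potential, List.map_congr_left h1, List.map_const', List.sum_replicate, nsmul_eq_mul]
    calc _ ≤ b ^ S.card * b ^ ((free D a).card - S.card) := by gcongr
      _ = _ := by rw [← pow_add, Nat.add_sub_cancel' hS]
  · rw [step_of_not D v a h]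
    simp [potential]

theorem potential_flatMap_step_le [NeZero q] {b : ℝ} (hb : 1 ≤ b)
    (hq : ∀ s ≤ m, (q : ℝ) ^ s - 1 ≤ b ^ s)
    (D : Data q n) (v : Fin m → Option (Fin n)) (W : List (Fin n → Option (Fin q))) :
    potential b D (W.flatMap (step branch D v)) ≤ potential b D W := by
  induction W with
  | nil => rfl
  | cons a W ih =>
    have := potential_step_le hb hq D v a
    simp only [potential, List.flatMap_cons, List.map_append, List.sum_append, List.map_cons,
      List.sum_cons] at *
    exact add_le_add this ih

theorem length_le_potential {b : ℝ} (hb : 1 ≤ b) (D : Data q n) (W : List (Fin n → Option (Fin q))) :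
    (W.length : ℝ) ≤ potential b D W := by
  induction W with
  | nil => simp [potential]
  | cons a W ih =>
    have := one_le_pow₀ hb (n := (free D a).card)
    simp only [potential, List.map_cons, List.sum_cons, List.length_cons] at *
    push_cast
    linarith

theorem exists_mem_processTuples [NeZero q] {D : Data q n} {g : Fin n → Fin q}
    (hg : ∀ u : Fin m → Fin n, FitsOn D g u) (us : List (Fin m → Fin n))
    (W : List (Fin n → Option (Fin q))) (h : ∃ a ∈ W, Ext D a g) :
    ∃ a ∈ processTuples branch D W (us.map total), Ext D a g := by
  induction us generalizing W with
  | nil => exact h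
  | cons u us ih =>
    obtain ⟨a, ha, he⟩ := h
    obtain ⟨a', ha', he'⟩ := exists_mem_step_ext he (hg u)
    exact ih _ ⟨a', List.mem_flatMap.2 ⟨a, ha, ha'⟩, he'⟩

/-- A refinement has fewer extensions, so a tuple that has been settled stays settled. This is why
one pass through the tuples suffices. -/
theorem settled_of_mem_processTuples [NeZero q] {D : Data q n} (us : List (Fin m → Fin n))
    (W : List (Fin n → Option (Fin q))) {a} (h : a ∈ processTuples branch D W (us.map total)) :
    (∃ a' ∈ W, ∀ g, Ext D a g → Ext D a' g) ∧ ∀ u ∈ us, Settled D u a := by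
  induction us generalizing W with
  | nil => exact ⟨⟨a, h, fun _ => id⟩, by simp⟩
  | cons u us ih =>
    obtain ⟨⟨a', ha', he⟩, h2⟩ := ih (W.flatMap (step branch D (total u))) h
    obtain ⟨a'', ha'', h3⟩ := List.mem_flatMap.1 ha'
    refine ⟨⟨a'', ha'', fun g hg => ext_of_mem_step h3 (he g hg)⟩, ?_⟩
    intro u' hu'
    rcases List.mem_cons.1 hu' with rfl | hu'
    · exact fun g hg => settled_of_mem_step h3 g (he g hg)
    · exact h2 u' hu'

theorem mem_tuples {is : List (Fin m)} {v w : Fin m → Option (Fin n)} :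
    w ∈ tuples is v ↔ (∀ i ∈ is, (w i).isSome) ∧ ∀ i ∉ is, w i = v i := by
  induction is generalizing v with
  | nil => simp [tuples, funext_iff]
  | cons i is ih =>
    simp only [tuples, List.mem_flatMap, List.mem_finRange, true_and, ih]
    constructor
    · rintro ⟨j, h1, h2⟩
      refine ⟨fun k hk => ?_, fun k hk => ?_⟩
      · by_cases hk' : k ∈ is
        · exact h1 k hk'
        · rcases List.mem_cons.1 hk with rfl | h
          · rw [h2 k hk']; simp
          · exact absurd h hk'
      · rw [h2 k fun h => hk (List.mem_cons_of_mem _ h)]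
        exact Function.update_of_ne (by rintro rfl; exact hk List.mem_cons_self) _ _
    · rintro ⟨h1, h2⟩
      obtain ⟨j, hj⟩ := Option.isSome_iff_exists.1 (h1 i List.mem_cons_self)
      refine ⟨j, fun k hk => h1 k (List.mem_cons_of_mem _ hk), fun k hk => ?_⟩
      rcases eq_or_ne k i with rfl | hki
      · simp [hj]
      · rw [Function.update_of_ne hki]
        exact h2 k fun h => (List.mem_cons.1 h).elim hki hk

theorem tuples_eq_map (m n : ℕ) : ∃ us : List (Fin m → Fin n),
    tuples (List.finRange m) (fun _ => none) = us.map total ∧ ∀ u, u ∈ us := by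
  have h : ∀ w ∈ tuples (n := n) (List.finRange m) (fun _ => none), w ∈ Set.range total := by
    intro w hw
    have := (mem_tuples.1 hw).1
    simp only [List.mem_finRange, true_imp_iff] at this
    exact ⟨fun i => (w i).get (this i), funext fun i => by simp [total]⟩
  obtain ⟨us, hus⟩ := (Set.range_list_map (total (m := m) (n := n))).symm ▸
    (show _ ∈ {l : List (Fin m → Option (Fin n)) | ∀ w ∈ l, w ∈ Set.range total} from h)
  refine ⟨us, hus.symm, fun u => ?_⟩
  have : total u ∈ us.map total := hus ▸ mem_tuples.2 ⟨fun _ _ => rfl, by simp⟩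
  obtain ⟨u', hu', e⟩ := List.mem_map.1 this
  have : u' = u := funext fun i => Option.some.inj (congrFun e i)
  exact this ▸ hu'

/-- Correctness of the algorithm, in terms of the settled assignments. -/
theorem processTuples_ne_nil_iff [NeZero q] (D : Data q n) (P : Prop)
    (hP : P → ∃ g : Fin n → Fin q, ∀ u : Fin m → Fin n, FitsOn D g u)
    (hS : ∀ g : Fin n → Fin q, (∀ u : Fin m → Fin n, ∃ g',
      (∀ i, D.X (u i) = true → g' (u i) = g (u i)) ∧ FitsOn D g' u) → P) :
    processTuples branch D [fun _ => none] (tuples (List.finRange m) fun _ => none) ≠ [] ↔ P := by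
  obtain ⟨us, e, hus⟩ := tuples_eq_map m n
  rw [e]
  constructor
  · intro h
    obtain ⟨a, ha⟩ := List.exists_mem_of_ne_nil _ h
    have h1 := (settled_of_mem_processTuples us _ ha).2
    -- Every completion of a surviving assignment works. Here the free vertices receive color `0`.
    refine hS (fun w => (a w).getD 0) fun u => h1 u (hus u) (fun w => (a w).getD 0) fun w c _ hc => ?_
    simp [hc]
  · intro h
    obtain ⟨g, hg⟩ := hP h
    obtain ⟨a, ha, -⟩ := exists_mem_processTuples hg us [fun _ => none]
      ⟨_, List.mem_singleton_self _, fun _ _ _ h => nomatch h⟩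
    exact List.ne_nil_of_mem ha

/-- As `b` tends to `q` from below, `b ^ s` tends to `q ^ s`, which exceeds `q ^ s - 1`. Only
finitely many exponents are involved. -/
theorem exists_base (q m : ℕ) (hq : 2 ≤ q) :
    ∃ b : ℝ, 1 ≤ b ∧ b < q ∧ ∀ s ≤ m, (q : ℝ) ^ s - 1 ≤ b ^ s := by
  have hq' : (1 : ℝ) < q := by exact_mod_cast hq
  have h1 : ∀ s ∈ Finset.range (m + 1), ∀ᶠ b in nhdsWithin (q : ℝ) (Set.Iio q), (q : ℝ) ^ s - 1 < b ^ s := by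
    intro s _
    have : Filter.Tendsto (fun b : ℝ => b ^ s) (nhdsWithin (q : ℝ) (Set.Iio q)) (nhds ((q : ℝ) ^ s)) :=
      ((continuous_pow s).tendsto _).mono_left nhdsWithin_le_nhds
    exact this.eventually_const_lt (by linarith)
  have h2 := (Filter.eventually_all_finset _).2 h1
  have h3 : ∀ᶠ b in nhdsWithin (q : ℝ) (Set.Iio q), 1 < b :=
    nhdsWithin_le_nhds (eventually_gt_nhds hq')
  obtain ⟨b, ⟨hb, hb1⟩, hbq⟩ := ((h2.and h3).and self_mem_nhdsWithin).exists
  exact ⟨b, hb1.le, hbq, fun s hs => (hb s (Finset.mem_range.2 (by omega))).le⟩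

end Branching

/-! ### Certificates of bounded size for cographs. -/

namespace ListColoring

variable {V α : Type*}

/-- The vertices in `s` have a proper coloring with colors from the lists `L`. -/
def ListCol (G : SimpleGraph V) (L : V → Finset α) (s : Finset V) : Prop :=
  ∃ γ : V → α, ∀ v ∈ s, γ v ∈ L v ∧ ∀ w ∈ s, G.Adj v w → γ v ≠ γ w

/-- Every uncolorable instance on `s` contains one on at most `c` vertices. -/
def HasCert (G : SimpleGraph V) (L : V → Finset α) (s : Finset V) (c : ℕ) : Prop :=
  ¬ ListCol G L s → ∃ t ⊆ s, t.card ≤ c ∧ ¬ ListCol G L t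

theorem listCol_empty [Nonempty α] (G : SimpleGraph V) (L : V → Finset α) : ListCol G L ∅ :=
  ⟨fun _ => Classical.arbitrary α, by simp⟩

theorem not_listCol_singleton {G : SimpleGraph V} {L : V → Finset α} {v : V} (h : L v = ∅) :
    ¬ ListCol G L {v} := by
  rintro ⟨γ, hγ⟩
  have := (hγ v (by simp)).1
  simp [h] at this

theorem listCol_union [DecidableEq V] {G : SimpleGraph V} {L : V → Finset α} {s t : Finset V}
    (hs : ListCol G L s) (ht : ListCol G L t) (hd : Disjoint s t)
    (h : ∀ v ∈ s, ∀ w ∈ t, ¬ G.Adj v w) : ListCol G L (s ∪ t) := by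
  obtain ⟨γ, hγ⟩ := hs
  obtain ⟨δ, hδ⟩ := ht
  refine ⟨fun v => if v ∈ s then γ v else δ v, fun v hv => ?_⟩
  have hd' : ∀ v ∈ t, v ∉ s := fun v hv hv' => Finset.disjoint_left.1 hd hv' hv
  rcases Finset.mem_union.1 hv with hv | hv
  · simp only [hv, if_true]
    refine ⟨(hγ v hv).1, fun w hw hvw => ?_⟩
    rcases Finset.mem_union.1 hw with hw | hw
    · simp only [hw, if_true]
      exact (hγ v hv).2 w hw hvw
    · exact absurd hvw (h v hv w hw)
  · simp only [hd' v hv, if_false]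
    refine ⟨(hδ v hv).1, fun w hw hvw => ?_⟩
    rcases Finset.mem_union.1 hw with hw | hw
    · exact absurd hvw.symm (h w hw v hv)
    · simp only [hd' w hw, if_false]
      exact (hδ v hv).2 w hw hvw

/-- When the lists only have `k` colors, every uncolorable instance has a certificate of bounded
size. -/
def Bounded (α : Type*) (G : SimpleGraph V) (k c : ℕ) : Prop :=
  ∀ (S : Finset α) (L : V → Finset α) (s : Finset V), S.card ≤ k → (∀ v ∈ s, L v ⊆ S) →
    HasCert G L s c

theorem bounded_zero [Nonempty α] (G : SimpleGraph V) : Bounded α G 0 1 := by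
  intro S L s hS hL h
  obtain rfl : S = ∅ := Finset.card_eq_zero.1 (Nat.le_zero.1 hS)
  rcases s.eq_empty_or_nonempty with rfl | ⟨v, hv⟩
  · exact absurd (listCol_empty G L) h
  · exact ⟨{v}, by simpa using hv, by simp,
      not_listCol_singleton (Finset.subset_empty.1 (hL v hv))⟩

theorem Bounded.mono {G : SimpleGraph V} {k c c' : ℕ} (h : Bounded α G k c) (hc : c ≤ c') :
    Bounded α G k c' := by
  intro S L s hS hL hn
  obtain ⟨t, h1, h2, h3⟩ := h S L s hS hL hn
  exact ⟨t, h1, h2.trans hc, h3⟩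

/-- There is no induced path `a b c d`. -/
def NoPath (G : SimpleGraph V) : Prop :=
  ∀ a b c d, G.Adj a b → G.Adj b c → G.Adj c d → a ≠ c → b ≠ d → a ≠ d →
    G.Adj a c ∨ G.Adj b d ∨ G.Adj a d

theorem noPath_of_cograph {V : Type} {G : SimpleGraph V} (h : GraphClass.cograph V G) : NoPath G := by
  intro a b c d hab hbc hcd h1 h2 h3
  by_contra! hn
  obtain ⟨h4, h5, h6⟩ := hn
  have h4' := fun h : G.Adj c a => h4 h.symm
  have h5' := fun h : G.Adj d b => h5 h.symm
  have h6' := fun h : G.Adj d a => h6 h.symm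
  refine h ⟨⟨⟨![a, b, c, d], ?_⟩, ?_⟩⟩
  · intro i j hij
    fin_cases i <;> fin_cases j <;> simp_all [G.ne_of_adj hab, G.ne_of_adj hbc, G.ne_of_adj hcd]
  · intro i j
    change G.Adj (![a, b, c, d] i) (![a, b, c, d] j) ↔ _
    fin_cases i <;> fin_cases j <;>
      simp_all [SimpleGraph.pathGraph_adj, hab.symm, hbc.symm, hcd.symm]

/-- The path on four vertices is self-complementary: an induced path `a b c d` in the complement is
an induced path `b d a c` in `G`. -/
theorem NoPath.compl {G : SimpleGraph V} (h : NoPath G) : NoPath Gᶜ := by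
  intro a b c d hab hbc hcd h1 h2 h3
  simp only [SimpleGraph.compl_adj] at *
  by_contra! hn
  have h4 := hn.1 h1
  have h5 := hn.2.1 h2
  have h6 := hn.2.2 h3
  rcases h b d a c h5 h6.symm h4 hab.1.symm hcd.1.symm hbc.1 with h | h | h
  · exact hab.2 h.symm
  · exact hcd.2 h.symm
  · exact hbc.2 h

/-- `s` is the disjoint union of two nonempty parts without edges between them. -/
def Separated (G : SimpleGraph V) (s : Finset V) : Prop :=
  ∃ A B : Finset V, A.Nonempty ∧ B.Nonempty ∧ Disjoint A B ∧ (∀ v, v ∈ s ↔ v ∈ A ∨ v ∈ B) ∧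
    ∀ v ∈ A, ∀ w ∈ B, ¬ G.Adj v w

/-- The non-neighbors of `v` in `A` split off from the rest. An edge from such a vertex `a` to a
neighbor `b` of `v` in `A` would make `z v b a` an induced path. -/
theorem separated_insert_aux [DecidableEq V] {G : SimpleGraph V} (h : NoPath G) {A B : Finset V}
    {v x z : V} (hvA : v ∉ A) (hvB : v ∉ B) (hd : Disjoint A B) (he : ∀ a ∈ A, ∀ b ∈ B, ¬ G.Adj a b)
    (hz : z ∈ B) (hvz : G.Adj v z) (hx : x ∈ A) (hvx : ¬ G.Adj v x) {s : Finset V}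
    (hs : ∀ w, w ∈ s ↔ w = v ∨ w ∈ A ∨ w ∈ B) : Separated G s := by
  classical
  refine ⟨A.filter (¬ G.Adj v ·), s \ A.filter (¬ G.Adj v ·), ⟨x, by simp [hx, hvx]⟩,
    ⟨v, by simp [hs, hvA]⟩, Finset.disjoint_sdiff, fun w => ?_, fun a ha b hb hab => ?_⟩
  · have : w ∈ A → w ∈ s := fun hw => (hs w).2 (.inr (.inl hw))
    simp only [Finset.mem_filter, Finset.mem_sdiff]
    tauto
  · simp only [Finset.mem_filter, Finset.mem_sdiff, hs, not_and, not_not] at ha hb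
    obtain ⟨ha, hva⟩ := ha
    obtain ⟨rfl | hbA | hbB, hb2⟩ := hb
    · exact hva hab.symm
    · have hzb : z ≠ b := fun e => Finset.disjoint_left.1 hd hbA (e ▸ hz)
      have hza : z ≠ a := fun e => Finset.disjoint_left.1 hd ha (e ▸ hz)
      have hvne : v ≠ a := fun e => hvA (e ▸ ha)
      rcases h z v b a hvz.symm (hb2 hbA) hab.symm hzb hvne hza with h | h | h
      · exact he b hbA z hz h.symm
      · exact hva h
      · exact he a ha z hz h.symm
    · exact he a ha b hbB hab

theorem separated_insert [DecidableEq V] {G : SimpleGraph V} (h : NoPath G) {s : Finset V} {v : V}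
    (hv : v ∉ s) (hs : Separated G s) : Separated G (insert v s) ∨ Separated Gᶜ (insert v s) := by
  obtain ⟨A, B, hA, hB, hd, hAB, he⟩ := hs
  have hvA : v ∉ A := fun h => hv ((hAB v).2 (.inl h))
  have hvB : v ∉ B := fun h => hv ((hAB v).2 (.inr h))
  have he' : ∀ b ∈ B, ∀ a ∈ A, ¬ G.Adj b a := fun b hb a ha h => he a ha b hb h.symm
  have hs : ∀ w, w ∈ insert v s ↔ w = v ∨ w ∈ A ∨ w ∈ B := fun w => by
    rw [Finset.mem_insert, hAB]
  by_cases h1 : ∃ y ∈ A, G.Adj v y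
  · by_cases h2 : ∃ z ∈ B, G.Adj v z
    · obtain ⟨y, hy, hvy⟩ := h1
      obtain ⟨z, hz, hvz⟩ := h2
      by_cases h3 : ∃ x ∈ s, ¬ G.Adj v x
      · obtain ⟨x, hx, hvx⟩ := h3
        rcases (hAB x).1 hx with hx | hx
        · exact .inl (separated_insert_aux h hvA hvB hd he hz hvz hx hvx hs)
        · exact .inl (separated_insert_aux h hvB hvA hd.symm he' hy hvy hx hvx
            fun w => by rw [hs, or_comm (a := w ∈ A)])
      · push Not at h3
        refine .inr ⟨{v}, s, by simp, ⟨y, (hAB y).2 (.inl hy)⟩, by simpa using hv, by simp, ?_⟩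
        simp only [Finset.mem_singleton, forall_eq, SimpleGraph.compl_adj, not_and, not_not]
        exact fun w hw _ => h3 w hw
    · push Not at h2
      refine .inl ⟨insert v A, B, by simp, hB, by simp [hvB, hd], fun w => ?_, fun a ha b hb => ?_⟩
      · rw [hs, Finset.mem_insert, or_assoc]
      · rcases Finset.mem_insert.1 ha with rfl | ha
        · exact h2 b hb
        · exact he a ha b hb
  · push Not at h1
    refine .inl ⟨insert v B, A, by simp, hA, by simp [hvA, hd.symm], fun w => ?_, fun a ha b hb => ?_⟩
    · rw [hs, Finset.mem_insert, or_assoc, or_comm (a := w ∈ A)]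
    · rcases Finset.mem_insert.1 ha with rfl | ha
      · exact h1 b hb
      · exact he' a ha b hb

/-- The classical structure of cographs, by adding one vertex at a time. Closure under complement
lets a single insertion lemma serve both cases. -/
theorem separated_or [DecidableEq V] {G : SimpleGraph V} (h : NoPath G) (s : Finset V)
    (hs : 2 ≤ s.card) : Separated G s ∨ Separated Gᶜ s := by
  induction s using Finset.induction_on with
  | empty => simp at hs
  | insert v s hv ih =>
    rcases Nat.lt_or_ge s.card 2 with h2 | h2
    · rw [Finset.card_insert_of_notMem hv] at hs
      obtain ⟨w, rfl⟩ := Finset.card_eq_one.1 (show s.card = 1 by omega)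
      have hvw : v ≠ w := by simpa using hv
      by_cases hadj : G.Adj v w
      · exact .inr ⟨{v}, {w}, by simp, by simp, by simpa using hvw, by simp, by simp [hadj]⟩
      · exact .inl ⟨{v}, {w}, by simp, by simp, by simpa using hvw, by simp, by simp [hadj]⟩
    · rcases ih h2 with h3 | h3
      · exact separated_insert h hv h3
      · have := separated_insert h.compl hv h3
        rwa [compl_compl, or_comm] at this

/-- The certificate bound for cographs. -/
def cographBound : ℕ → ℕ
  | 0 => 1
  | k + 1 => 2 ^ (k + 1) * cographBound k

theorem cographBound_pos (k : ℕ) : 0 < cographBound k := by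
  induction k with
  | zero => exact Nat.one_pos
  | succ k ih => exact Nat.mul_pos (by positivity) ih

/-- In a proper coloring of a join, `A` and `B` use disjoint color sets. Hence for each `C ⊆ S`
either `A` is uncolorable from `C` or `B` is uncolorable from the colors outside `C`. The union of
one certificate for each of the at most `2 ^ (k + 1)` sets `C` is a certificate. -/
theorem hasCert_of_join [DecidableEq V] [DecidableEq α] {G : SimpleGraph V} {k : ℕ}
    (hk : Bounded α G k (cographBound k)) {S : Finset α} {L : V → Finset α} {s A B : Finset V}
    (hS : S.card ≤ k + 1) (hL : ∀ v ∈ s, L v ⊆ S) (hA : A.Nonempty) (hB : B.Nonempty)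
    (hs : ∀ v, v ∈ s ↔ v ∈ A ∨ v ∈ B) (he : ∀ v ∈ A, ∀ w ∈ B, G.Adj v w) :
    HasCert G L s (cographBound (k + 1)) := by
  intro hn
  have hd : ∀ v ∈ B, v ∉ A := fun v hv hv' => G.irrefl (he v hv' v hv)
  have key : ∀ C ∈ S.powerset, ∃ t ⊆ s, t.card ≤ cographBound k ∧
      ((t ⊆ A ∧ ¬ ListCol G (fun v => L v ∩ C) t) ∨ (t ⊆ B ∧ ¬ ListCol G (fun v => L v \ C) t)) := by
    intro C hC
    rw [Finset.mem_powerset] at hC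
    -- For `C = S` and `C = ∅` one side keeps all colors and induction is not available, but on the
    -- other side any vertex has an empty list.
    rcases eq_or_ne C S with rfl | hCS
    · obtain ⟨b, hb⟩ := hB
      exact ⟨{b}, by simp [hs, hb], cographBound_pos k, .inr ⟨by simpa using hb, not_listCol_singleton
        (Finset.sdiff_eq_empty_iff_subset.2 (hL b ((hs b).2 (.inr hb))))⟩⟩
    rcases C.eq_empty_or_nonempty with rfl | hC0
    · obtain ⟨a, ha⟩ := hA
      exact ⟨{a}, by simp [hs, ha], cographBound_pos k, .inl ⟨by simpa using ha,
        not_listCol_singleton (Finset.inter_empty _)⟩⟩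
    have hlt := Finset.card_lt_card (hC.ssubset_of_ne hCS)
    by_cases h1 : ListCol G (fun v => L v ∩ C) A
    · by_cases h2 : ListCol G (fun v => L v \ C) B
      · obtain ⟨γ, hγ⟩ := h1
        obtain ⟨δ, hδ⟩ := h2
        refine absurd ⟨fun v => if v ∈ A then γ v else δ v, fun v hv => ?_⟩ hn
        rcases (hs v).1 hv with hv | hv
        · simp only [hv, if_true]
          refine ⟨(Finset.mem_inter.1 (hγ v hv).1).1, fun w hw hvw => ?_⟩
          rcases (hs w).1 hw with hw | hw
          · simp only [hw, if_true]
            exact (hγ v hv).2 w hw hvw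
          · simp only [hd w hw, if_false]
            intro e
            exact (Finset.mem_sdiff.1 (hδ w hw).1).2 (e ▸ (Finset.mem_inter.1 (hγ v hv).1).2)
        · simp only [hd v hv, if_false]
          refine ⟨(Finset.mem_sdiff.1 (hδ v hv).1).1, fun w hw hvw => ?_⟩
          rcases (hs w).1 hw with hw | hw
          · simp only [hw, if_true]
            intro e
            exact (Finset.mem_sdiff.1 (hδ v hv).1).2 (e ▸ (Finset.mem_inter.1 (hγ w hw).1).2)
          · simp only [hd w hw, if_false]
            exact (hδ v hv).2 w hw hvw
      · obtain ⟨t, h3, h4, h5⟩ := hk (S \ C) _ B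
          (by
            rw [Finset.card_sdiff_of_subset hC]
            have := hC0.card_pos
            omega)
          (fun v hv => Finset.sdiff_subset_sdiff (hL v ((hs v).2 (.inr hv))) subset_rfl) h2
        exact ⟨t, fun v hv => (hs v).2 (.inr (h3 hv)), h4, .inr ⟨h3, h5⟩⟩
    · obtain ⟨t, h3, h4, h5⟩ := hk C _ A (by omega) (fun v _ => Finset.inter_subset_right) h1
      exact ⟨t, fun v hv => (hs v).2 (.inl (h3 hv)), h4, .inl ⟨h3, h5⟩⟩
  choose! T hTs hTc hT using key
  refine ⟨S.powerset.biUnion T, Finset.biUnion_subset.2 hTs, ?_, ?_⟩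
  · refine (Finset.card_biUnion_le_card_mul _ _ _ hTc).trans ?_
    rw [Finset.card_powerset]
    exact Nat.mul_le_mul_right _ (Nat.pow_le_pow_right two_pos hS)
  · rintro ⟨γ, hγ⟩
    set Z := S.powerset.biUnion T
    -- A coloring of the union would be refuted by the certificate for the set of colors that it
    -- uses on the `A` side.
    set C := (Z.filter (· ∈ A)).image γ
    have hZ : ∀ v ∈ Z, v ∈ s := fun v hv => Finset.biUnion_subset.2 hTs hv
    have hC : C ∈ S.powerset := by
      rw [Finset.mem_powerset]
      intro c hc
      obtain ⟨v, hv, rfl⟩ := Finset.mem_image.1 hc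
      have hv := (Finset.mem_filter.1 hv).1
      exact hL v (hZ v hv) (hγ v hv).1
    have hTZ : T C ⊆ Z := Finset.subset_biUnion_of_mem T hC
    rcases hT C hC with ⟨h1, h2⟩ | ⟨h1, h2⟩
    · refine h2 ⟨γ, fun v hv => ⟨Finset.mem_inter.2 ⟨(hγ v (hTZ hv)).1, ?_⟩, fun w hw =>
        (hγ v (hTZ hv)).2 w (hTZ hw)⟩⟩
      exact Finset.mem_image_of_mem _ (Finset.mem_filter.2 ⟨hTZ hv, h1 hv⟩)
    · refine h2 ⟨γ, fun v hv => ⟨Finset.mem_sdiff.2 ⟨(hγ v (hTZ hv)).1, fun hc => ?_⟩, fun w hw =>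
        (hγ v (hTZ hv)).2 w (hTZ hw)⟩⟩
      obtain ⟨w, hw, e⟩ := Finset.mem_image.1 hc
      obtain ⟨hw, hwA⟩ := Finset.mem_filter.1 hw
      exact (hγ w hw).2 v (hTZ hv) (he w hwA v (h1 hv)) e

/-- A disjoint union passes the certificate of an uncolorable part on, by the inner induction on the
vertex set. Only a join consumes a color. -/
theorem NoPath.bounded [Nonempty α] {G : SimpleGraph V} (h : NoPath G) (k : ℕ) :
    Bounded α G k (cographBound k) := by
  classical
  induction k with
  | zero => exact bounded_zero G
  | succ k ih =>
    intro S L s hS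
    induction s using Finset.strongInduction with
    | H s ih' =>
      intro hL hn
      rcases Nat.lt_or_ge s.card 2 with h2 | h2
      · have := cographBound_pos (k + 1)
        exact ⟨s, subset_rfl, by omega, hn⟩
      · have hrec : ∀ A B : Finset V, B.Nonempty → Disjoint A B → (∀ v, v ∈ s ↔ v ∈ A ∨ v ∈ B) →
            ¬ ListCol G L A → ∃ t ⊆ s, t.card ≤ cographBound (k + 1) ∧ ¬ ListCol G L t := by
          intro A B ⟨b, hb⟩ hd hAB hA
          have hsub : A ⊆ s := fun v hv => (hAB v).2 (.inl hv)
          have hss : A ⊂ s := Finset.ssubset_iff_subset_ne.2 ⟨hsub, fun e =>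
            Finset.disjoint_left.1 hd (e ▸ (hAB b).2 (.inr hb)) hb⟩
          obtain ⟨t, h3, h4⟩ := ih' A hss (fun v hv => hL v (hsub hv)) hA
          exact ⟨t, h3.trans hsub, h4⟩
        rcases separated_or h s h2 with ⟨A, B, hA, hB, hd, hAB, he⟩ | ⟨A, B, hA, hB, hd, hAB, he⟩
        · have hBA : ∀ v, v ∈ s ↔ v ∈ B ∨ v ∈ A := fun v => by rw [hAB, or_comm]
          by_cases h3 : ListCol G L A
          swap
          · exact hrec A B hB hd hAB h3
          by_cases h4 : ListCol G L B
          swap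
          · exact hrec B A hA hd.symm hBA h4
          refine absurd (listCol_union h3 h4 hd he) ?_
          rwa [show A ∪ B = s by ext v; rw [Finset.mem_union, hAB]]
        · refine hasCert_of_join ih hS hL hA hB hAB (fun v hv w hw => ?_) hn
          have := he v hv w hw
          rw [SimpleGraph.compl_adj, not_and, not_not] at this
          exact this fun e => Finset.disjoint_left.1 hd hv (e ▸ hw)

end ListColoring

/-! ### Simplicial vertices of chordal graphs, and certificates for cochordal graphs. -/

namespace ListColoring

variable {V α : Type*}

theorem cycleGraph_adj_val {m : ℕ} {i j : Fin m} (hm : 2 ≤ m) : (SimpleGraph.cycleGraph m).Adj i j ↔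
    i.val + 1 = j.val ∨ j.val + 1 = i.val ∨ (i.val = 0 ∧ j.val + 1 = m) ∨ (j.val = 0 ∧ i.val + 1 = m) := by
  rw [SimpleGraph.cycleGraph_adj']
  have hi := i.2
  have hj := j.2
  rcases lt_trichotomy i j with h | rfl | h
  · rw [Fin.coe_sub_iff_lt.2 h, Fin.sub_val_of_le h.le]
    rw [Fin.lt_def] at h
    omega
  · rw [Fin.sub_val_of_le le_rfl]
    omega
  · rw [Fin.coe_sub_iff_lt.2 h, Fin.sub_val_of_le h.le]
    rw [Fin.lt_def] at h
    omega

theorem not_chordal_of_cycle {V : Type} {H : SimpleGraph V} {m : ℕ} (hm : 4 ≤ m) (f : ℕ → V)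
    (hf : ∀ i j, i < j → j < m → f i ≠ f j)
    (ha : ∀ i j, i < j → j < m → (H.Adj (f i) (f j) ↔ j = i + 1 ∨ (i = 0 ∧ j + 1 = m))) :
    ¬ GraphClass.chordal V H := by
  refine fun h => h m hm ⟨⟨⟨fun i => f i, fun i j hij => ?_⟩, fun {i j} => ?_⟩⟩
  · rcases lt_trichotomy i.val j.val with h | h | h
    · exact absurd hij (hf _ _ h j.2)
    · exact Fin.ext h
    · exact absurd hij.symm (hf _ _ h i.2)
  · change H.Adj (f i) (f j) ↔ _
    rw [cycleGraph_adj_val (by omega)]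
    rcases lt_trichotomy i.val j.val with h | h | h
    · rw [ha _ _ h j.2]
      omega
    · rw [h]
      have : ¬ H.Adj (f j) (f j) := H.irrefl
      simp only [this, false_iff]
      omega
    · rw [H.adj_comm, ha _ _ h i.2]
      omega

/-- The edges of `H` inside `U`. -/
def restrict (H : SimpleGraph V) (U : Set V) : SimpleGraph V where
  Adj a b := H.Adj a b ∧ a ∈ U ∧ b ∈ U
  symm := ⟨fun _ _ h => ⟨h.1.symm, h.2.2, h.2.1⟩⟩
  loopless := ⟨fun _ h => H.irrefl h.1⟩

theorem restrict_mono (H : SimpleGraph V) {U U' : Set V} (h : U ⊆ U') :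
    restrict H U ≤ restrict H U' := fun _ _ hab => ⟨hab.1, h hab.2.1, h hab.2.2⟩

theorem adj_getVert_of_shortest {H : SimpleGraph V} {y z : V} {p : H.Walk y z}
    (hp : p.length = H.dist y z) {i j : ℕ} (hij : i < j) (hj : j ≤ p.length)
    (h : H.Adj (p.getVert i) (p.getVert j)) : j = i + 1 := by
  have := SimpleGraph.dist_le ((p.take i).append (.cons h (p.drop j)))
  simp only [SimpleGraph.Walk.length_append, SimpleGraph.Walk.length_cons,
    SimpleGraph.Walk.take_length, SimpleGraph.Walk.drop_length] at this
  omega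

/-- If `y` and `z` were not adjacent, a shortest path between them through `U` would have no chords.
Its inner vertices are not adjacent to `v`, so together with `v` it would form an induced cycle. -/
theorem adj_of_reachable {V : Type} {H : SimpleGraph V} (hH : GraphClass.chordal V H) {v y z : V}
    {U : Set V} (hU : ∀ x ∈ U, x ≠ v ∧ ¬ H.Adj v x) (hy : H.Adj v y) (hz : H.Adj v z) (hyz : y ≠ z)
    (hr : (restrict H (insert y (insert z U))).Reachable y z) : H.Adj y z := by
  by_contra hn
  obtain ⟨p, hp⟩ := hr.exists_walk_length_eq_dist
  have hpath := p.isPath_of_length_eq_dist hp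
  have hd : 1 < p.length := by
    rw [hp]
    exact hr.one_lt_dist_of_ne_of_not_adj hyz fun h => hn h.1
  have hmem : ∀ i ≤ p.length, p.getVert i ∈ insert y (insert z U) := by
    intro i hi
    rcases hi.lt_or_eq with hi | rfl
    · exact (p.adj_getVert_succ hi).2.1
    · rw [p.getVert_length]
      simp
  have h0 : ∀ i ≤ p.length, p.getVert i = y → i = 0 := fun i hi e =>
    hpath.getVert_injOn (show i ≤ _ from hi) (Nat.zero_le _) (by simpa using e)
  have h1 : ∀ i ≤ p.length, p.getVert i = z → i = p.length := fun i hi e =>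
    hpath.getVert_injOn (show i ≤ _ from hi) (le_refl p.length) (by simpa using e)
  -- The cycle consists of the `p.length + 1` vertices of the path and `v`, with `p.length` at least
  -- `2`.
  refine not_chordal_of_cycle (m := p.length + 2) (by omega)
    (fun i => if i ≤ p.length then p.getVert i else v) (fun i j hij hj => ?_)
    (fun i j hij hj => ?_) hH
  all_goals
    rw [if_pos (by omega)]
    rcases Nat.lt_or_ge p.length j with hj' | hj'
  · rw [if_neg (by omega)]
    rcases hmem i (by omega) with h | h | h
    · rw [h]; exact hy.ne'
    · rw [h]; exact hz.ne'
    · exact (hU _ h).1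
  · rw [if_pos hj']
    exact fun e => hij.ne (hpath.getVert_injOn (show i ≤ _ by omega) hj' e)
  · rw [if_neg (by omega)]
    obtain rfl : j = p.length + 1 := by omega
    have hi : i ≤ p.length := by omega
    constructor
    · intro h
      rcases hmem i hi with h' | h' | h'
      · exact .inr ⟨h0 i hi h', rfl⟩
      · exact .inl (by rw [h1 i hi h'])
      · exact absurd h.symm (hU _ h').2
    · rintro (h | h)
      · obtain rfl : i = p.length := by omega
        rw [p.getVert_length]
        exact hz.symm
      · rw [h.1, p.getVert_zero]
        exact hy.symm
  · rw [if_pos hj']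
    constructor
    · intro h
      exact .inl (adj_getVert_of_shortest hp hij hj' ⟨h, hmem i (by omega), hmem j hj'⟩)
    · rintro (rfl | h)
      · exact (p.adj_getVert_succ (by omega)).1
      · omega

/-- The neighbors of `w` in `s` form a clique. -/
def Simplicial (H : SimpleGraph V) (s : Finset V) (w : V) : Prop :=
  ∀ x ∈ s, ∀ y ∈ s, H.Adj w x → H.Adj w y → x ≠ y → H.Adj x y

/-- Let `C` be the component of `x` among the non-neighbors of `v` in `s`, and `N` its boundary.
Then `N` lies in the neighborhood of `v` and is a clique by `adj_of_reachable`. The induction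
hypothesis for `C ∪ N` and the clique `N` gives a simplicial vertex in `C`, and all its neighbors in
`s` lie in `C ∪ N`. -/
theorem exists_simplicial_of_not_universal {V : Type} {H : SimpleGraph V}
    (hH : GraphClass.chordal V H) {s : Finset V}
    (ih : ∀ t ⊂ s, ∀ K ⊂ t, H.IsClique (K : Set V) → ∃ w ∈ t, w ∉ K ∧ Simplicial H t w)
    {v x : V} (hv : v ∈ s) (hx : x ∈ s) (hvx : v ≠ x) (hna : ¬ H.Adj v x) :
    ∃ w ∈ s, v ≠ w ∧ ¬ H.Adj v w ∧ Simplicial H s w := by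
  classical
  set U : Set V := {u | u ∈ s ∧ u ≠ v ∧ ¬ H.Adj v u} with hUdef
  set C := s.filter fun u => u ∈ U ∧ (restrict H U).Reachable x u
  set N := s.filter fun u => u ∉ C ∧ ∃ c ∈ C, H.Adj c u
  have hxU : x ∈ U := ⟨hx, hvx.symm, hna⟩
  have hxC : x ∈ C := Finset.mem_filter.2 ⟨hx, hxU, .refl _⟩
  have hCU : ∀ c ∈ C, c ∈ U ∧ (restrict H U).Reachable x c := fun c hc => (Finset.mem_filter.1 hc).2
  have hN : ∀ u ∈ N, H.Adj v u := by
    intro u hu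
    obtain ⟨hus, huC, c, hc, hcu⟩ := Finset.mem_filter.1 hu
    obtain ⟨hc1, hc2⟩ := hCU c hc
    by_contra hn
    by_cases huv : u = v
    · exact hc1.2.2 (huv ▸ hcu.symm)
    · have huU : u ∈ U := ⟨hus, huv, hn⟩
      exact huC (Finset.mem_filter.2 ⟨hus, huU, hc2.trans (SimpleGraph.Adj.reachable ⟨hcu, hc1, huU⟩)⟩)
  have hNC : H.IsClique (N : Set V) := by
    intro y hy z hz hyz
    obtain ⟨hys, hyC, c, hc, hcy⟩ := Finset.mem_filter.1 (Finset.mem_coe.1 hy)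
    obtain ⟨hzs, hzC, d, hd, hdz⟩ := Finset.mem_filter.1 (Finset.mem_coe.1 hz)
    refine adj_of_reachable hH (U := U) (fun u hu => hu.2) (hN y hy) (hN z hz) hyz ?_
    have hsub : U ⊆ insert y (insert z U) := fun u hu => .inr (.inr hu)
    have hcd : (restrict H (insert y (insert z U))).Reachable c d :=
      ((hCU c hc).2.symm.trans (hCU d hd).2).mono (restrict_mono H hsub)
    refine .trans (SimpleGraph.Adj.reachable ⟨hcy.symm, .inl rfl, hsub (hCU c hc).1⟩) (hcd.trans
      (SimpleGraph.Adj.reachable ⟨hdz, hsub (hCU d hd).1, .inr (.inl rfl)⟩))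
  have hvC : v ∉ C := fun h => (hCU v h).1.2.1 rfl
  have hvN : v ∉ N := fun h => H.irrefl (hN v h)
  obtain ⟨w, hw, hwN, hsim⟩ := ih (C ∪ N)
    (Finset.ssubset_iff_subset_ne.2 ⟨Finset.union_subset (Finset.filter_subset _ _)
      (Finset.filter_subset _ _), fun e => by
        rw [← e, Finset.mem_union] at hv
        exact hv.elim hvC hvN⟩) N
    (Finset.ssubset_iff_subset_ne.2 ⟨Finset.subset_union_right, fun e => by
      have : x ∈ N := e ▸ Finset.mem_union_left _ hxC
      exact (Finset.mem_filter.1 this).2.1 hxC⟩) hNC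
  have hwC : w ∈ C := (Finset.mem_union.1 hw).resolve_right hwN
  have hnb : ∀ a ∈ s, H.Adj w a → a ∈ C ∪ N := by
    intro a ha hwa
    rw [Finset.mem_union]
    by_cases h : a ∈ C
    · exact .inl h
    · exact .inr (Finset.mem_filter.2 ⟨ha, h, w, hwC, hwa⟩)
  exact ⟨w, (hCU w hwC).1.1, (hCU w hwC).1.2.1.symm, (hCU w hwC).1.2.2, fun a ha b hb h1 h2 =>
    hsim a (hnb a ha h1) b (hnb b hb h2) h1 h2⟩

/-- Dirac's theorem. Asking for a simplicial vertex outside a given clique makes the induction work,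
since the clique can be taken to be a separator. -/
theorem exists_simplicial {V : Type} {H : SimpleGraph V} (hH : GraphClass.chordal V H) (s : Finset V) :
    ∀ K ⊂ s, H.IsClique (K : Set V) → ∃ w ∈ s, w ∉ K ∧ Simplicial H s w := by
  classical
  induction s using Finset.strongInduction with
  | H s ih =>
    have key : ∀ K ⊂ s, K.Nonempty → H.IsClique (K : Set V) → ∃ w ∈ s, w ∉ K ∧ Simplicial H s w := by
      intro K hK hK0 hKc
      by_cases hu : ∃ v ∈ K, ∃ x ∈ s, v ≠ x ∧ ¬ H.Adj v x
      · obtain ⟨v, hv, x, hx, hvx, hna⟩ := hu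
        obtain ⟨w, hw, hvw, hna', hsim⟩ :=
          exists_simplicial_of_not_universal hH ih (hK.1 hv) hx hvx hna
        exact ⟨w, hw, fun hwK => hna' (hKc hv hwK hvw), hsim⟩
      -- Now `K` is complete to everything, so a vertex that is simplicial in `s \ K` remains so in
      -- `s`.
      · push Not at hu
        obtain ⟨w, hw, -, hsim⟩ := ih (s \ K) (Finset.sdiff_ssubset hK.1 hK0) ∅
          (by rw [Finset.empty_ssubset, Finset.sdiff_nonempty]; exact hK.2) (by simp)
        rw [Finset.mem_sdiff] at hw
        refine ⟨w, hw.1, hw.2, fun a ha b hb h1 h2 hab => ?_⟩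
        by_cases haK : a ∈ K
        · exact hu a haK b hb hab
        · by_cases hbK : b ∈ K
          · exact (hu b hbK a ha hab.symm).symm
          · exact hsim a (Finset.mem_sdiff.2 ⟨ha, haK⟩) b (Finset.mem_sdiff.2 ⟨hb, hbK⟩) h1 h2 hab
    intro K hK hKc
    rcases K.eq_empty_or_nonempty with rfl | hK0
    · obtain ⟨v, hv⟩ := Finset.empty_ssubset.1 hK
      rcases eq_or_ne s {v} with rfl | hsv
      · refine ⟨v, hv, by simp, fun a ha b hb => ?_⟩
        rw [Finset.mem_singleton] at ha hb
        exact fun _ _ h => absurd (ha.trans hb.symm) h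
      · obtain ⟨w, hw, -, hsim⟩ := key {v} (Finset.ssubset_iff_subset_ne.2
          ⟨Finset.singleton_subset_iff.2 hv, hsv.symm⟩) (by simp) (by simp)
        exact ⟨w, hw, by simp, hsim⟩
    · exact key K hK hK0 hKc

/-- The certificate bound for cochordal graphs. -/
def cochordalBound : ℕ → ℕ
  | 0 => 1
  | k + 1 => 1 + (k + 1) * cochordalBound k

/-- Let `v` be simplicial in the complement, so that its non-neighbors in `s` are independent in
`G`. For each color `c` of `v`, the neighbors of `v` and the vertices that do not allow `c` are
uncolorable without `c`. The certificate is `v` together with one certificate for each `c`. -/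
theorem bounded_of_cochordal [Nonempty α] {V : Type} {G : SimpleGraph V}
    (hG : GraphClass.cochordal V G) (k : ℕ) : Bounded α G k (cochordalBound k) := by
  classical
  induction k with
  | zero => exact bounded_zero G
  | succ k ih =>
    intro S L s hS hL hn
    rcases s.eq_empty_or_nonempty with rfl | hs
    · exact absurd (listCol_empty G L) hn
    obtain ⟨v, hv, -, hsim⟩ := exists_simplicial hG s ∅ (Finset.empty_ssubset.2 hs) (by simp)
    have key : ∀ c ∈ L v, ∃ t ⊆ s.filter (fun w => G.Adj v w ∨ (w ≠ v ∧ c ∉ L w)),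
        t.card ≤ cochordalBound k ∧ ¬ ListCol G (fun w => (L w).erase c) t := by
      intro c hc
      refine ih (S.erase c) _ _ ?_ (fun w hw => Finset.erase_subset_erase _
        (hL w (Finset.mem_filter.1 hw).1)) ?_
      · rw [Finset.card_erase_of_mem (hL v hv hc)]
        omega
      · rintro ⟨γ, hγ⟩
        -- Color `c` goes to `v` and to all its non-neighbors that allow it. These are pairwise
        -- non-adjacent, and `γ` does not use `c`.
        refine hn ⟨fun w => if G.Adj v w ∨ (w ≠ v ∧ c ∉ L w) then γ w else c, fun w hw => ?_⟩
        by_cases h1 : G.Adj v w ∨ (w ≠ v ∧ c ∉ L w)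
        · have hw' := hγ w (Finset.mem_filter.2 ⟨hw, h1⟩)
          simp only [h1, if_true]
          refine ⟨Finset.mem_of_mem_erase hw'.1, fun x hx hwx => ?_⟩
          by_cases h2 : G.Adj v x ∨ (x ≠ v ∧ c ∉ L x)
          · simp only [h2, if_true]
            exact hw'.2 x (Finset.mem_filter.2 ⟨hx, h2⟩) hwx
          · simp only [h2, if_false]
            exact Finset.ne_of_mem_erase hw'.1
        · simp only [h1, if_false]
          push Not at h1
          refine ⟨?_, fun x hx hwx => ?_⟩
          · rcases eq_or_ne w v with rfl | h
            · exact hc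
            · exact h1.2 h
          by_cases h2 : G.Adj v x ∨ (x ≠ v ∧ c ∉ L x)
          · simp only [h2, if_true]
            exact (Finset.ne_of_mem_erase (hγ x (Finset.mem_filter.2 ⟨hx, h2⟩)).1).symm
          · push Not at h2
            exfalso
            have hwv : v ≠ w := fun e => h2.1 (e ▸ hwx)
            have hxv : v ≠ x := fun e => h1.1 (e ▸ hwx.symm)
            have := hsim w hw x hx ((SimpleGraph.compl_adj _ _ _).2 ⟨hwv, h1.1⟩)
              ((SimpleGraph.compl_adj _ _ _).2 ⟨hxv, h2.1⟩) hwx.ne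
            exact ((SimpleGraph.compl_adj _ _ _).1 this).2 hwx
    choose! T hTs hTc hT using key
    have hZ : ∀ c ∈ L v, ∀ w ∈ T c, w ∈ s ∧ (G.Adj v w ∨ (w ≠ v ∧ c ∉ L w)) := fun c hc w hw =>
      Finset.mem_filter.1 (hTs c hc hw)
    refine ⟨insert v ((L v).biUnion T), ?_, ?_, ?_⟩
    · exact Finset.insert_subset hv (Finset.biUnion_subset.2 fun c hc w hw => (hZ c hc w hw).1)
    · refine (Finset.card_insert_le _ _).trans ?_
      have := Finset.card_biUnion_le_card_mul _ _ _ hTc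
      have h2 : (L v).card ≤ k + 1 := (Finset.card_le_card (hL v hv)).trans hS
      have h3 := Nat.mul_le_mul_right (cochordalBound k) h2
      rw [cochordalBound]
      omega
    · rintro ⟨γ, hγ⟩
      have hc := (hγ v (Finset.mem_insert_self _ _)).1
      have hsub : T (γ v) ⊆ insert v ((L v).biUnion T) :=
        (Finset.subset_biUnion_of_mem T hc).trans (Finset.subset_insert _ _)
      refine hT _ hc ⟨γ, fun w hw => ⟨Finset.mem_erase.2 ⟨?_, (hγ w (hsub hw)).1⟩, fun x hx =>
        (hγ w (hsub hw)).2 x (hsub hx)⟩⟩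
      rcases (hZ _ hc w hw).2 with h | h
      · exact ((hγ v (Finset.mem_insert_self _ _)).2 w (hsub hw) h).symm
      · exact fun e => h.2 (e ▸ (hγ w (hsub hw)).1)

/-- On an induced cycle of the complement, `W` contains no two consecutive vertices and meets every
non-adjacent pair. The first few vertices of the cycle already contradict this. -/
theorem cochordal_of_split {V : Type} {G : SimpleGraph V} (h : GraphClass.split V G) :
    GraphClass.cochordal V G := by
  obtain ⟨W, hW, hI⟩ := h
  rintro m hm ⟨e⟩
  have h1 : ∀ i j, (SimpleGraph.cycleGraph m).Adj i j → ¬ (e i ∈ W ∧ e j ∈ W) := by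
    rintro i j hij ⟨hi, hj⟩
    have := (SimpleGraph.compl_adj _ _ _).1 (e.map_adj_iff.2 hij)
    exact this.2 (hW hi hj this.1)
  have h2 : ∀ i j, i ≠ j → ¬ (SimpleGraph.cycleGraph m).Adj i j → e i ∈ W ∨ e j ∈ W := by
    intro i j hij hn
    by_contra! hc
    have hne : e i ≠ e j := fun h => hij (e.injective h)
    exact hn (e.map_adj_iff.1 ((SimpleGraph.compl_adj _ _ _).2 ⟨hne, hI hc.1 hc.2 hne⟩))
  have hm2 : 2 ≤ m := by omega
  have h01 := h1 ⟨0, by omega⟩ ⟨1, by omega⟩ ((cycleGraph_adj_val hm2).2 (by simp))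
  have h12 := h1 ⟨1, by omega⟩ ⟨2, by omega⟩ ((cycleGraph_adj_val hm2).2 (by simp))
  have h23 := h1 ⟨2, by omega⟩ ⟨3, by omega⟩ ((cycleGraph_adj_val hm2).2 (by simp))
  have h02 := h2 ⟨0, by omega⟩ ⟨2, by omega⟩ (by simp)
    (fun h => by have := (cycleGraph_adj_val hm2).1 h; simp at this; omega)
  have h13 := h2 ⟨1, by omega⟩ ⟨3, by omega⟩ (by simp)
    (fun h => by have := (cycleGraph_adj_val hm2).1 h; simp at this)
  rcases hm.eq_or_lt with rfl | hm
  · have h03 := h1 ⟨0, by omega⟩ ⟨3, by omega⟩ ((cycleGraph_adj_val hm2).2 (by simp))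
    tauto
  · have h34 := h1 ⟨3, by omega⟩ ⟨4, by omega⟩ ((cycleGraph_adj_val hm2).2 (by simp))
    have h24 := h2 ⟨2, by omega⟩ ⟨4, by omega⟩ (by simp)
      (fun h => by have := (cycleGraph_adj_val hm2).1 h; simp at this)
    tauto

theorem listCol_map_iff [Nonempty α] {G : SimpleGraph V} {L : V → Finset α} {U : Set V}
    (s : Finset U) : ListCol G L (s.map (Function.Embedding.subtype _)) ↔
      ListCol (G.induce U) (fun u => L u) s := by
  classical
  constructor
  · rintro ⟨γ, hγ⟩
    exact ⟨fun u => γ u, fun v hv => ⟨(hγ v (Finset.mem_map_of_mem _ hv)).1, fun w hw hvw =>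
      (hγ v (Finset.mem_map_of_mem _ hv)).2 w (Finset.mem_map_of_mem _ hw) hvw⟩⟩
  · rintro ⟨γ, hγ⟩
    refine ⟨fun v => if h : v ∈ U then γ ⟨v, h⟩ else Classical.arbitrary α, fun v hv => ?_⟩
    obtain ⟨v, hvs, rfl⟩ := Finset.mem_map.1 hv
    refine ⟨by simpa using (hγ v hvs).1, fun w hw hvw => ?_⟩
    obtain ⟨w, hws, rfl⟩ := Finset.mem_map.1 hw
    simpa using (hγ v hvs).2 w hws hvw

/-- Certificates in an induced subgraph are certificates in the graph. -/
theorem hasCert_of_induce [Nonempty α] {G : SimpleGraph V} {U : Set V} {k c : ℕ}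
    (h : Bounded α (G.induce U) k c) {S : Finset α} {L : V → Finset α} {s : Finset V}
    (hS : S.card ≤ k) (hL : ∀ v ∈ s, L v ⊆ S) (hs : ∀ v ∈ s, v ∈ U) : HasCert G L s c := by
  classical
  intro hn
  have e : (s.subtype (· ∈ U)).map (Function.Embedding.subtype _) = s := by
    rw [Finset.subtype_map, Finset.filter_true_of_mem hs]
  rw [← e, listCol_map_iff] at hn
  obtain ⟨t, h1, h2, h3⟩ := h S _ _ hS (fun v hv => hL v (Finset.mem_subtype.1 hv)) hn
  refine ⟨t.map (Function.Embedding.subtype _), ?_, by rwa [Finset.card_map], fun h =>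
    h3 ((listCol_map_iff t).1 h)⟩
  rw [← e]
  exact Finset.map_subset_map.2 h1

/-- Colorings of the classes combine, so an uncolorable instance is uncolorable on a single class,
and its certificate can be taken there. -/
theorem bounded_of_setoid [Nonempty α] {G : SimpleGraph V} {k c : ℕ} (r : Setoid V)
    (hr : ∀ u v, G.Adj u v → r u v)
    (h : ∀ v, Bounded α (G.induce {u | r u v}) k c) : Bounded α G k c := by
  classical
  intro S L s hS hL hn
  by_contra hno
  have key : ∀ v : V, ListCol G L (s.filter (r · v)) := by
    intro v
    by_contra hv
    obtain ⟨t, h1, h2, h3⟩ := hasCert_of_induce (h v) hS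
      (fun w hw => hL w (Finset.mem_filter.1 hw).1) (fun w hw => (Finset.mem_filter.1 hw).2) hv
    exact hno ⟨t, h1.trans (Finset.filter_subset _ _), h2, h3⟩
  choose γ hγ using key
  -- The coloring is chosen by the representative, so that all vertices of a class use the same one.
  refine hn ⟨fun v => γ (Quotient.mk r v).out v, fun v hv => ?_⟩
  have hrv : r v (Quotient.mk r v).out := r.symm (Quotient.mk_out v)
  have hv' := hγ _ v (Finset.mem_filter.2 ⟨hv, hrv⟩)
  refine ⟨hv'.1, fun w hw hvw => ?_⟩
  have e : Quotient.mk r w = Quotient.mk r v := Quotient.sound (r.symm (hr v w hvw))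
  change γ _ v ≠ γ (Quotient.mk r w).out w
  rw [e]
  exact hv'.2 w (Finset.mem_filter.2 ⟨hw, r.trans (r.symm (hr v w hvw)) hrv⟩) hvw

theorem cograph_of_independent {V : Type} {G : SimpleGraph V} (h : GraphClass.independent V G) :
    GraphClass.cograph V G := fun ⟨e⟩ =>
  h _ _ (e.map_adj_iff.2 (SimpleGraph.pathGraph_adj.2 (show (0 : Fin 4).val + 1 = (1 : Fin 4).val ∨ _
    from .inl rfl)))

/-- The four graph classes have certificates of bounded size. -/
theorem exists_bounded [Nonempty α] (k : ℕ) : ∃ c, ∀ F ∈ ({GraphClass.independent,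
    GraphClass.disjointUnions GraphClass.split, GraphClass.disjointUnions GraphClass.cochordal,
    GraphClass.cograph} : Set GraphClass), ∀ (V : Type) (G : SimpleGraph V), F V G → Bounded α G k c := by
  refine ⟨max (cographBound k) (cochordalBound k), ?_⟩
  rintro F (rfl | rfl | rfl | rfl) V G hG
  · exact ((noPath_of_cograph (cograph_of_independent hG)).bounded k).mono (le_max_left _ _)
  · obtain ⟨r, h1, h2⟩ := hG
    refine bounded_of_setoid r h1 fun v => ?_
    exact (bounded_of_cochordal (cochordal_of_split (h2 v)) k).mono (le_max_right _ _)
  · obtain ⟨r, h1, h2⟩ := hG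
    exact bounded_of_setoid r h1 fun v => (bounded_of_cochordal (h2 v) k).mono (le_max_right _ _)
  · exact ((noPath_of_cograph hG).bounded k).mono (le_max_left _ _)

end ListColoring

/-! ### From local extensions to a coloring, and the conclusion. -/

namespace Branching

open ListColoring

variable {q m n : ℕ}

theorem exists_tuple (T : Finset (Fin n)) (hT : T.Nonempty) (hm : T.card ≤ m) :
    ∃ u : Fin m → Fin n, ∀ w ∈ T, w ∈ Set.range u := by
  have : Nonempty T := hT.to_subtype
  obtain ⟨e⟩ : Nonempty (T ↪ Fin m) := Function.Embedding.nonempty_of_card_le (by simpa using hm)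
  exact ⟨fun i => (Function.invFun e i : T), fun w hw =>
    ⟨e ⟨w, hw⟩, congrArg Subtype.val (Function.leftInverse_invFun e.injective _)⟩⟩

/-- A coloring of the modulator that extends to every set of at most `m` vertices extends to the
whole graph. -/
theorem listCol_of_local [NeZero q] {G : SimpleGraph (Fin n)} {X : Finset (Fin n)}
    {L : Fin n → Finset (Fin q)} {c : ℕ} (hc : Bounded (Fin q) (G.induce {v | v ∉ X}) q c)
    (hm : 2 ≤ m) (hcm : c * (1 + q) ≤ m) (g : Fin n → Fin q)
    (hg : ∀ T : Finset (Fin n), T.card ≤ m → ∃ g' : Fin n → Fin q, (∀ v ∈ T, v ∈ X → g' v = g v) ∧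
      ∀ v ∈ T, g' v ∈ L v ∧ ∀ w ∈ T, G.Adj v w → g' v ≠ g' w) :
    ListCol G L Finset.univ := by
  classical
  -- Sets of two vertices show that `g` itself is proper on the modulator, hence `2 ≤ m`.
  have hX : ∀ v ∈ X, ∀ w ∈ X, g v ∈ L v ∧ (G.Adj v w → g v ≠ g w) := by
    intro v hv w hw
    obtain ⟨g', h1, h2⟩ := hg {v, w} (Finset.card_le_two.trans hm)
    rw [← h1 v (by simp) hv, ← h1 w (by simp) hw]
    exact ⟨(h2 v (by simp)).1, (h2 v (by simp)).2 w (by simp)⟩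
  set L' : Fin n → Finset (Fin q) := fun v => (L v).filter fun c => ∀ x ∈ X, G.Adj x v → g x ≠ c
  have key : ListCol G L' (Finset.univ.filter (· ∉ X)) := by
    by_contra hn
    obtain ⟨t, ht, htc, htn⟩ := hasCert_of_induce hc (S := Finset.univ) (by simp)
      (fun _ _ => Finset.subset_univ _) (fun v hv => (Finset.mem_filter.1 hv).2) hn
    -- One modulator neighbor of color `c` suffices to witness that `c` is forbidden at `v`. Thus
    -- `t` and its witnesses have at most `c * (1 + q)` vertices.
    set B : Fin n → Fin q → Finset (Fin n) := fun v c =>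
      if h : ∃ x ∈ X, G.Adj x v ∧ g x = c then {h.choose} else ∅
    have hB : ∀ v c, (B v c).card ≤ 1 := by
      intro v c
      simp only [B]
      split <;> simp
    set T := t ∪ t.biUnion fun v => Finset.univ.biUnion (B v)
    have hT : T.card ≤ m := by
      refine ((Finset.card_union_le _ _).trans (Nat.add_le_add htc ?_)).trans
        ((by ring : c + c * (q * 1) = c * (1 + q)).trans_le hcm)
      refine (Finset.card_biUnion_le_card_mul _ _ (q * 1) fun v _ => ?_).trans
        (Nat.mul_le_mul_right _ htc)
      refine (Finset.card_biUnion_le_card_mul _ _ 1 fun c _ => hB v c).trans ?_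
      simp
    obtain ⟨g', h1, h2⟩ := hg T hT
    have htT : t ⊆ T := Finset.subset_union_left
    refine htn ⟨g', fun v hv => ⟨Finset.mem_filter.2 ⟨(h2 v (htT hv)).1, fun x hx hxv e => ?_⟩,
      fun w hw => (h2 v (htT hv)).2 w (htT hw)⟩⟩
    have hex : ∃ x ∈ X, G.Adj x v ∧ g x = g' v := ⟨x, hx, hxv, e⟩
    have hmem : hex.choose ∈ T := by
      refine Finset.mem_union_right _ (Finset.mem_biUnion.2 ⟨v, hv, Finset.mem_biUnion.2
        ⟨g' v, Finset.mem_univ _, ?_⟩⟩)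
      simp only [B, dif_pos hex, Finset.mem_singleton]
    obtain ⟨h3, h4, h5⟩ := hex.choose_spec
    exact (h2 _ hmem).2 v (htT hv) h4 ((h1 _ hmem h3).trans h5)
  obtain ⟨δ, hδ⟩ := key
  have hδ' : ∀ v, v ∉ X → δ v ∈ L' v ∧ ∀ w, w ∉ X → G.Adj v w → δ v ≠ δ w := fun v hv =>
    ⟨(hδ v (by simpa using hv)).1, fun w hw => (hδ v (by simpa using hv)).2 w (by simpa using hw)⟩
  refine ⟨fun v => if v ∈ X then g v else δ v, fun v _ => ?_⟩
  by_cases hv : v ∈ X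
  · simp only [hv, if_true]
    refine ⟨(hX v hv v hv).1, fun w _ hvw => ?_⟩
    by_cases hw : w ∈ X
    · simp only [hw, if_true]
      exact (hX v hv w hw).2 hvw
    · simp only [hw, if_false]
      exact (Finset.mem_filter.1 (hδ' w hw).1).2 v hv hvw
  · simp only [hv, if_false]
    refine ⟨(Finset.mem_filter.1 (hδ' v hv).1).1, fun w _ hvw => ?_⟩
    by_cases hw : w ∈ X
    · simp only [hw, if_true]
      exact ((Finset.mem_filter.1 (hδ' v hv).1).2 w hw hvw.symm).symm
    · simp only [hw, if_false]
      exact (hδ' v hv).2 w hw hvw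

/-- The machine's data represent a graph, a modulator and lists. -/
structure Represents (D : Data q n) (G : SimpleGraph (Fin n)) (X : Finset (Fin n))
    (L : Fin n → Finset (Fin q)) : Prop where
  adj : ∀ u v, D.A u v = true ↔ G.Adj u v
  mem : ∀ v, D.X v = true ↔ v ∈ X
  lst : ∀ v c, D.lst v c = true ↔ c ∈ L v

/-- The algorithm decides list colorability. -/
theorem Represents.processTuples_iff [NeZero q] {D : Data q n} {G : SimpleGraph (Fin n)}
    {X : Finset (Fin n)} {L : Fin n → Finset (Fin q)} (hD : Represents D G X L) {c : ℕ}
    (hc : Bounded (Fin q) (G.induce {v | v ∉ X}) q c) (hm : 2 ≤ m) (hcm : c * (1 + q) ≤ m) :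
    processTuples branch D [fun _ => none] (tuples (List.finRange m) fun _ => none) ≠ [] ↔
      ListCol G L Finset.univ := by
  apply processTuples_ne_nil_iff
  · rintro ⟨g, hg⟩
    exact ⟨g, fun u => ⟨fun i => (hD.lst _ _).2 (hg _ (Finset.mem_univ _)).1, fun i j h =>
      (hg _ (Finset.mem_univ _)).2 _ (Finset.mem_univ _) ((hD.adj _ _).1 h).symm⟩⟩
  · intro g hg
    refine listCol_of_local hc hm hcm g fun T hT => ?_
    -- A tuple that covers `T` repeats vertices of `T` to fill its positions, so the empty set is
    -- treated separately.
    rcases T.eq_empty_or_nonempty with rfl | hT0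
    · exact ⟨g, by simp, by simp⟩
    obtain ⟨u, hu⟩ := exists_tuple T hT0 hT
    obtain ⟨g', h1, h2, h3⟩ := hg u
    refine ⟨g', fun v hv hvX => ?_, fun v hv => ?_⟩
    · obtain ⟨i, rfl⟩ := hu v hv
      exact h1 i ((hD.mem _).2 hvX)
    · obtain ⟨i, rfl⟩ := hu v hv
      refine ⟨(hD.lst _ _).1 (h2 i), fun w hw hvw => ?_⟩
      obtain ⟨j, rfl⟩ := hu w hw
      exact h3 i j ((hD.adj _ _).2 hvw.symm)

/-- The input word. -/
def word (b : Bool) (D : Data q n) : List Bool :=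
  List.replicate n true ++ [false] ++ flat ((List.finRange n).map D.A) ++ block D.X ++
    (if b then (List.finRange n).flatMap fun v => (List.finRange q).map (D.lst v) else [])

theorem le_length_word (b : Bool) (D : Data q n) : n ≤ (word b D).length := by
  simp only [word, List.length_append, List.length_replicate]
  omega

/-- A problem whose instances are represented by the machine's data is solved by the machine. -/
theorem solvableInOStar_of_represents [NeZero q] (b : Bool) {P : ParamProblem} {β : ℝ} (hβ : 1 ≤ β)
    (hβm : ∀ s ≤ m, (q : ℝ) ^ s - 1 ≤ β ^ s) {c : ℕ} (hm : 2 ≤ m) (hcm : c * (1 + q) ≤ m)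
    (h : ∀ x : P.Inst, ∃ (n : ℕ) (D : Data q n) (G : SimpleGraph (Fin n)) (X : Finset (Fin n))
      (L : Fin n → Finset (Fin q)), Represents D G X L ∧ (b = false → D.lst = fun _ _ => true) ∧
      Bounded (Fin q) (G.induce {v | v ∉ X}) q c ∧ P.encode x = word b D ∧ P.param x = X.card ∧
      (P.IsYes x ↔ ListCol G L Finset.univ)) : P.SolvableInOStar β := by
  have : Fintype (Stk m) := Fintype.ofFinite _
  have : Fintype (Reg q m) := Fintype.ofFinite _
  have : Fintype (Alph q (.inp : Stk m)) := inferInstanceAs (Fintype Bool)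
  refine StackProg.solvableInOStar (Γ := Alph q (m := m)) .inp (Equiv.refl Bool) (default : Reg q m)
    (mainProg b branch) (fun r => r.flag) P hβ
    -- The factor `2` comes from `N + 1 ≤ 2 * β ^ k` for `N = ⌊β ^ k⌋`.
    (2 * ((Fintype.card (Fin m → Option (Fin q)) + 4) * 10 + 32 * m + q + 100)) (m + 2) fun x => ?_
  obtain ⟨n, D, G, X, L, hD, hlst, hc, hword, hpar, hyes⟩ := h x
  have hX : ((free D fun _ => none).card : ℕ) = X.card := by
    congr 1
    ext v
    -- The identity above makes the potential of the initial list exactly `β ^ k`. The invariant for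
    -- the run is that the potential never exceeds this value.
    simp [free, hD.mem]
  obtain ⟨S', ⟨t, ht, hrun⟩, hflag⟩ := does_mainProg b (branch (m := m)) D hlst ⌊β ^ X.card⌋₊
    (fun W => potential β D W ≤ β ^ X.card)
    (fun W v hW => (potential_flatMap_step_le hβ hβm D v W).trans hW)
    (fun W hW => Nat.le_floor ((length_le_potential hβ D W).trans hW))
    (by simp [potential, hX])
  refine ⟨S'.reg, S'.stk, t, ?_, ?_, ?_⟩
  · rw [hword, hpar]
    set K := (Fintype.card (Fin m → Option (Fin q)) + 4) * 10 + 32 * m + q + 100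
    have h1 : (1 : ℝ) ≤ β ^ X.card := one_le_pow₀ hβ
    have h2 : (⌊β ^ X.card⌋₊ : ℝ) ≤ β ^ X.card := Nat.floor_le (by linarith)
    have h3 : (n : ℝ) ≤ (word b D).length := by exact_mod_cast le_length_word b D
    calc (t : ℝ) ≤ K * (n + 1) ^ (m + 2) * (⌊β ^ X.card⌋₊ + 1) := by exact_mod_cast ht
      _ ≤ K * ((word b D).length + 1) ^ (m + 2) * (β ^ X.card + β ^ X.card) := by gcongr
      _ = _ := by push_cast; ring
  · rw [hword]
    convert hrun using 1
    funext k
    cases k <;> simp [Mem.stk, word]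
  · rw [hyes, ← hD.processTuples_iff hc hm hcm]
    refine hflag.trans ⟨?_, .inr⟩
    rintro (rfl | h)
    · rw [hD.processTuples_iff hc hm hcm]
      exact ⟨fun v => v.elim0, fun v => v.elim0⟩
    · exact h

end Branching

theorem mainTheorem8 (q : ℕ) (hq : 2 ≤ q) :
    ∃ ε : ℝ, 0 < ε ∧ ε < q ∧
      ∀ F ∈ ({GraphClass.independent, GraphClass.disjointUnions GraphClass.split,
          GraphClass.disjointUnions GraphClass.cochordal, GraphClass.cograph} : Set GraphClass),
        (qColoring q F).SolvableInOStar ((q : ℝ) - ε) ∧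
        (qListColoring q F).SolvableInOStar ((q : ℝ) - ε) := by
  classical
  have : NeZero q := ⟨by omega⟩
  obtain ⟨c, hc⟩ := ListColoring.exists_bounded (α := Fin q) q
  -- The tuples must cover two modulator vertices, or a certificate with its forbidding neighbors.
  -- One `c` for all four classes gives one `β` for all eight problems.
  obtain ⟨β, hβ1, hβq, hβ⟩ := Branching.exists_base q (2 + c * (1 + q)) hq
  refine ⟨q - β, by linarith, by linarith, fun F hF => ?_⟩
  rw [sub_sub_cancel]
  constructor
  · refine Branching.solvableInOStar_of_represents false hβ1 hβ (Nat.le_add_right _ _) (Nat.le_add_left _ _)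
      fun I => ?_
    change ModulatorGraph F at I
    refine ⟨I.n, ⟨fun u v => decide (I.graph.Adj u v), fun v => decide (v ∈ I.modulator),
      fun _ _ => true⟩, I.graph, I.modulator, fun _ => Finset.univ, ⟨by simp, by simp, by simp⟩,
      fun _ => rfl, hc F hF _ _ I.rest_mem, ?_, rfl, ?_⟩
    · simp [qColoring, ModulatorGraph.encode, Branching.word, Branching.flat, Branching.block, List.flatMap_map]
    · constructor
      · rintro ⟨γ⟩
        exact ⟨γ, fun v _ => ⟨Finset.mem_univ _, fun w _ h => γ.valid h⟩⟩
      · rintro ⟨γ, hγ⟩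
        exact ⟨.mk γ fun {v w} h => (hγ v (Finset.mem_univ _)).2 w (Finset.mem_univ _) h⟩
  · refine Branching.solvableInOStar_of_represents true hβ1 hβ (Nat.le_add_right _ _) (Nat.le_add_left _ _) ?_
    rintro ⟨I, Λ⟩
    refine ⟨I.n, ⟨fun u v => decide (I.graph.Adj u v), fun v => decide (v ∈ I.modulator),
      fun v c => decide (c ∈ Λ v)⟩, I.graph, I.modulator, Λ, ⟨by simp, by simp, by simp⟩,
      nofun, hc F hF _ _ I.rest_mem, ?_, rfl, ?_⟩
    · simp [qListColoring, ModulatorGraph.encode, Branching.word, Branching.flat, Branching.block, List.flatMap_map]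
    · constructor
      · rintro ⟨γ, hγ⟩
        exact ⟨γ, fun v _ => ⟨hγ v, fun w _ h => γ.valid h⟩⟩
      · rintro ⟨γ, hγ⟩
        exact ⟨.mk γ fun {v w} h => (hγ v (Finset.mem_univ _)).2 w (Finset.mem_univ _) h,
          fun v => (hγ v (Finset.mem_univ _)).1⟩
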